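/- Let $\mathcal A=(A,B,C,S_B,S_C,\Delta_B,\Delta_C)$ be a multiplier bialgebroid over $\mathbb C$: $A$ is a non-degenerate idempotent algebra, $B,C\subseteq M(A)$ are subalgebras of its multiplier algebra with anti-isomorphisms $S_B\colon B\to C$, $S_C\colon C\to B$, $(A,B,\iota_B,S_B,\Delta_B)$ is a left and $(A,C,\iota_C,S_C,\Delta_C)$ a right multiplier bialgebroid, and the mixed co-associativity conditions \[ ((\Delta_B\otimes\iota)((1\otimes c)\Delta_C(b)))(a\otimes1\otimes1)=(1\otimes1\otimes c)((\iota\otimes\Delta_C)(\Delta_B(b)(a\otimes1))), \] \[ (a\otimes1\otimes1)((\Delta_C\otimes\iota)(\Delta_B(b)(1\otimes c)))=((\iota\otimes\Delta_B)((a\otimes1)\Delta_C(b)))(1\otimes1\otimes c) \] hold for all $a,b,c\in A$. For $x\in B$, $y\in C$ and $a,b\in A$, consider the quotients of $A\otimes A$ by the indicated relations \[ {}_BA\otimes A^B:\ xa\otimes b=a\otimes S_B(x)b,\qquad {}^CA\otimes A_C:\ aS_C(y)\otimes b=a\otimes by, \] \[ A_B\otimes{}_BA:\ ax\otimes b=a\otimes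 xb,\qquad A_C\otimes{}_CA:\ ay\otimes b=a\otimes yb, \] \[ {}_BA\otimes A_B:\ xa\otimes b=a\otimes bx,\qquad {}_CA\otimes A_C:\ ya\otimes b=a\otimes by, \] and the canonical maps \[ T_\lambda\colon {}_CA\otimes A_C\to{}_BA\otimes A^B,\ a\otimes b\mapsto\Delta_B(b)(a\otimes1),\qquad T_\rho\colon A_B\otimes{}_BA\to{}_BA\otimes A^B,\ a\otimes b\mapsto\Delta_B(a)(1\otimes b), \] \[ {}_\lambda T\colon A_C\otimes{}_CA\to{}^CA\otimes A_C,\ a\otimes b\mapsto(a\otimes1)\Delta_C(b),\qquad {}_\rho T\colon {}_BA\otimes A_B\to{}^CA\otimes A_C,\ a\otimes b\mapsto(1\otimes b)\Delta_C(a). \] Let $A^B$, ${}^CA$ denote $A$ with $a\cdot x=S_B(x)a$ and $y\cdot a=aS_C(y)$, and let ${}_BI$, $I^B$, $I_C$, ${}^CI$ be the linear spans of all $\omega(a)$, where $a\in A$ and $\omega$ runs through $\mathrm{Hom}({}_BA,{}_BB)$, $\mathrm{Hom}(A^B,B_B)$, $\mathrm{Hom}(A_C,C_C)$, $\mathrm{Hom}({}^CA,{}_CC)$,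 respectively. Assume that $\mathcal A$ is a regular multiplier Hopf algebroid, that is, all four canonical maps are bijective and $S_B({}_BI)A=I^BA=A\,S_C(I_C)=A\,{}^CI=A$. Let $S$ be its antipode, that is, an anti-automorphism of $A$ such that $S(xyax'y')=S_C(y')S_B(x')S(a)S_C(y)S_B(x)$ for all $x,x'\in B$, $y,y'\in C$, $a\in A$, and such that for some left counit $\varepsilon_B$ and some right counit $\varepsilon_C$ of $\mathcal A$ one has, for all $a,b\in A$, \[ m(S\otimes\iota)T_\rho(a\otimes b)=S_C(\varepsilon_C(a))b,\qquad m(\iota\otimes S)\,{}_\lambda T(a\otimes b)=a\,S_B(\varepsilon_B(b)), \] where $m$ is the multiplication. Write $\Sigma$ for the flip $a\otimes b\mapsto b\otimes a$. Then the following two squares, each divided into two triangles by its diagonal, commute: \[ (S\otimes\iota)\Sigma\circ{}_\lambda T=\Sigma T_\rho^{-1}\circ T_\lambda\Sigma={}_\rho T^{-1}\circ(S\otimes\iota)\Sigma \quad\text{as maps } A_C\otimes{}_CA\to{}_BA\otimes A_B, \] \[ (\iota\otimes S)\Sigma\circ T_\rho=\Sigma\,{}_\lambda T^{-1}\circ{}_\rho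 T\Sigma=T_\lambda^{-1}\circ(\iota\otimes S)\Sigma \quad\text{as maps } A_B\otimes{}_BA\to{}_CA\otimes A_C. \] In particular, $T_\rho(\iota\otimes S)\,{}_\lambda T=T_\lambda\Sigma$ as maps $A_C\otimes{}_CA\to{}_BA\otimes A^B$. -/

import Mathlib

set_option linter.unusedSectionVars false

namespace MultHopf

open scoped TensorProduct

variable {A : Type*} [NonUnitalRing A] [Module ℂ A] [IsScalarTower ℂ A A] [SMulCommClass ℂ A A]

/-! ### Multipliers -/

variable (A) in
/-- The multiplier algebra `M(A)`: pairs `m` of a left multiplier `a ↦ m a` and a right multiplier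
`a ↦ a m` with `a (m b) = (a m) b`. -/
def multiplierAlgebra : Subalgebra ℂ (Module.End ℂ A × (Module.End ℂ A)ᵐᵒᵖ) where
  carrier := {m | (∀ a b : A, m.1 (a * b) = m.1 a * b) ∧
    (∀ a b : A, m.2.unop (a * b) = a * m.2.unop b) ∧
    ∀ a b : A, a * m.1 b = m.2.unop a * b}
  mul_mem' := by
    rintro m n ⟨h1, h2, h3⟩ ⟨k1, k2, k3⟩
    refine ⟨fun a b => ?_, fun a b => ?_, fun a b => ?_⟩
    · simp [k1, h1]
    · simp [k2, h2]
    · simp [k3, h3]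
  add_mem' := by
    rintro m n ⟨h1, h2, h3⟩ ⟨k1, k2, k3⟩
    refine ⟨fun a b => ?_, fun a b => ?_, fun a b => ?_⟩
    · simp [k1, h1, add_mul]
    · simp [k2, h2, mul_add]
    · simp [k3, h3, mul_add, add_mul]
  algebraMap_mem' := by
    intro r
    refine ⟨fun a b => ?_, fun a b => ?_, fun a b => ?_⟩ <;>
      simp [Algebra.algebraMap_eq_smul_one, smul_mul_assoc, mul_smul_comm]

variable (A) in
/-- The multiplier algebra of `A`, as a type. -/
def Mult : Type _ := multiplierAlgebra A

instance : Ring (Mult A) := inferInstanceAs (Ring (multiplierAlgebra A))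

instance : Algebra ℂ (Mult A) := inferInstanceAs (Algebra ℂ (multiplierAlgebra A))

/-- Left multiplication `a ↦ m a` by a multiplier. -/
def lm (m : Mult A) : Module.End ℂ A := m.1.1

/-- Right multiplication `a ↦ a m` by a multiplier. -/
def rm (m : Mult A) : Module.End ℂ A := m.1.2.unop

@[simp] theorem lm_add (m n : Mult A) : lm (m + n) = lm m + lm n := rfl

@[simp] theorem rm_add (m n : Mult A) : rm (m + n) = rm m + rm n := rfl

@[simp] theorem lm_smul (r : ℂ) (m : Mult A) : lm (r • m) = r • lm m := rfl

@[simp] theorem rm_smul (r : ℂ) (m : Mult A) : rm (r • m) = r • rm m := rfl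

theorem lm_mul_apply (m n : Mult A) (a : A) : lm (m * n) a = lm m (lm n a) := rfl

theorem rm_mul_apply (m n : Mult A) (a : A) : rm (m * n) a = rm n (rm m a) := rfl

theorem lm_mul (m : Mult A) (a b : A) : lm m (a * b) = lm m a * b := m.2.1 a b

theorem rm_mul (m : Mult A) (a b : A) : rm m (a * b) = a * rm m b := m.2.2.1 a b

theorem mul_lm (m : Mult A) (a b : A) : a * lm m b = rm m a * b := m.2.2.2 a b

theorem lm_rm (h : ∀ a : A, (∀ b : A, b * a = 0) → a = 0) (m n : Mult A) (a : A) :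
    lm m (rm n a) = rm n (lm m a) := by
  rw [← sub_eq_zero]
  refine h _ fun c => ?_
  rw [mul_sub, sub_eq_zero, mul_lm, ← rm_mul, ← rm_mul, mul_lm]

/-- A family `f` of operators on `A` (the action of a base algebra) is idempotent: the elements
`f i a` span `A`. -/
def Idem {I : Type*} (f : I → Module.End ℂ A) : Prop :=
  Submodule.span ℂ {z : A | ∃ i a, z = f i a} = ⊤

/-- The action `f` of a base algebra on `A` is faithful. -/
def Faith {I : Type*} [Zero I] (f : I → Module.End ℂ A) : Prop :=
  ∀ i, (∀ a, f i a = 0) → i = 0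

theorem Idem.hom_ext {I X : Type*} [AddCommGroup X] [Module ℂ X] {f : I → Module.End ℂ A}
    (h : Idem f) {F G : A →ₗ[ℂ] X} (H : ∀ i a, F (f i a) = G (f i a)) : F = G :=
  LinearMap.ext_on h (by rintro _ ⟨i, a, rfl⟩; exact H i a)

/-! ### Balanced tensor products -/

/-- The relations `f i a ⊗ b = a ⊗ g i b`. -/
def balRel {I : Type*} (f g : I → Module.End ℂ A) : Submodule ℂ (A ⊗[ℂ] A) :=
  Submodule.span ℂ {z | ∃ i a b, z = f i a ⊗ₜ[ℂ] b - a ⊗ₜ[ℂ] g i b}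

/-- The tensor product of two copies of `A`, balanced with respect to the actions `f` on the first
and `g` on the second copy. -/
abbrev Bal {I : Type*} (f g : I → Module.End ℂ A) := (A ⊗[ℂ] A) ⧸ balRel f g

/-- The class of `a ⊗ b`. -/
def Bal.mk {I : Type*} (f g : I → Module.End ℂ A) : A →ₗ[ℂ] A →ₗ[ℂ] Bal f g :=
  TensorProduct.curry (balRel f g).mkQ

theorem Bal.mk_bal {I : Type*} (f g : I → Module.End ℂ A) (i : I) (a b : A) :
    Bal.mk f g (f i a) b = Bal.mk f g a (g i b) := by
  refine (Submodule.Quotient.eq _).2 (Submodule.subset_span ⟨i, a, b, rfl⟩)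

/-- A linear map on `A ⊗ A` that respects the relations descends. -/
def Bal.desc {I X : Type*} [AddCommGroup X] [Module ℂ X] {f g : I → Module.End ℂ A}
    (F : A ⊗[ℂ] A →ₗ[ℂ] X)
    (h : ∀ i a b, F (f i a ⊗ₜ[ℂ] b) = F (a ⊗ₜ[ℂ] g i b)) : Bal f g →ₗ[ℂ] X :=
  (balRel f g).liftQ F (Submodule.span_le.2 (by
    rintro _ ⟨i, a, b, rfl⟩
    simp [h]))

/-- The linear map `a ⊗ b ↦ F a b` on a balanced tensor product. -/
def Bal.lift {I X : Type*} [AddCommGroup X] [Module ℂ X] {f g : I → Module.End ℂ A}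
    (F : A →ₗ[ℂ] A →ₗ[ℂ] X) (h : ∀ i a b, F (f i a) b = F a (g i b)) : Bal f g →ₗ[ℂ] X :=
  Bal.desc (TensorProduct.lift F) (by simpa using h)

@[simp] theorem Bal.lift_mk {I X : Type*} [AddCommGroup X] [Module ℂ X]
    {f g : I → Module.End ℂ A} (F : A →ₗ[ℂ] A →ₗ[ℂ] X)
    (h : ∀ i a b, F (f i a) b = F a (g i b)) (a b : A) :
    Bal.lift F h (Bal.mk f g a b) = F a b := by
  change TensorProduct.lift F (a ⊗ₜ[ℂ] b) = F a b
  simp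

theorem Bal.hom_ext {I X : Type*} [AddCommGroup X] [Module ℂ X] {f g : I → Module.End ℂ A}
    {F G : Bal f g →ₗ[ℂ] X} (h : ∀ a b, F (Bal.mk f g a b) = G (Bal.mk f g a b)) : F = G := by
  apply Submodule.linearMap_qext
  apply TensorProduct.ext'
  exact h

/-- The operator `a ⊗ b ↦ p a ⊗ q b`. -/
def Bal.map {I : Type*} {f g : I → Module.End ℂ A} (p q : Module.End ℂ A)
    (hp : ∀ i a, p (f i a) = f i (p a)) (hq : ∀ i a, q (g i a) = g i (q a)) :
    Module.End ℂ (Bal f g) :=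
  Bal.lift ((Bal.mk f g).compl₁₂ p q) (fun i a b => by simp [hp, hq, Bal.mk_bal])

@[simp] theorem Bal.map_mk {I : Type*} {f g : I → Module.End ℂ A} (p q : Module.End ℂ A)
    (hp : ∀ i a, p (f i a) = f i (p a)) (hq : ∀ i a, q (g i a) = g i (q a)) (a b : A) :
    Bal.map p q hp hq (Bal.mk f g a b) = Bal.mk f g (p a) (q b) := by
  simp [Bal.map]

/-! ### Threefold tensor products -/

/-- The quotient of `A ⊗ A ⊗ A` by the relations `r₁` in the first two legs and `r₂` in the last
two legs. -/
abbrev Triple (r₁ r₂ : Submodule ℂ (A ⊗[ℂ] A)) :=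
  (A ⊗[ℂ] (A ⊗[ℂ] A)) ⧸
    (Submodule.span ℂ {z | ∃ u ∈ r₁, ∃ c : A, z = TensorProduct.assoc ℂ A A A (u ⊗ₜ[ℂ] c)} ⊔
      Submodule.span ℂ {z | ∃ a : A, ∃ u ∈ r₂, z = a ⊗ₜ[ℂ] u})

/-- The map `[a ⊗ b] ⊗ c ↦ [a ⊗ b ⊗ c]`. -/
def join12 (r₁ r₂ : Submodule ℂ (A ⊗[ℂ] A)) :
    ((A ⊗[ℂ] A) ⧸ r₁) ⊗[ℂ] A →ₗ[ℂ] Triple r₁ r₂ :=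
  TensorProduct.lift (r₁.liftQ
    (TensorProduct.curry
      (Submodule.mkQ _ ∘ₗ (TensorProduct.assoc ℂ A A A).toLinearMap)) (by
    intro u hu
    rw [LinearMap.mem_ker]
    ext c
    exact (Submodule.Quotient.mk_eq_zero _).2
      (Submodule.mem_sup_left (Submodule.subset_span ⟨u, hu, c, rfl⟩))))

/-- The map `a ⊗ [b ⊗ c] ↦ [a ⊗ b ⊗ c]`. -/
def join23 (r₁ r₂ : Submodule ℂ (A ⊗[ℂ] A)) :
    A ⊗[ℂ] ((A ⊗[ℂ] A) ⧸ r₂) →ₗ[ℂ] Triple r₁ r₂ :=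
  TensorProduct.lift (LinearMap.flip (r₂.liftQ
    (LinearMap.flip (TensorProduct.curry (Submodule.mkQ _))) (by
    intro u hu
    rw [LinearMap.mem_ker]
    ext a
    exact (Submodule.Quotient.mk_eq_zero _).2
      (Submodule.mem_sup_right (Submodule.subset_span ⟨a, u, hu, rfl⟩)))))

/-- For `F(a ⊗ b) ∈ A ⊗ A / r₁` and `G(b ⊗ c) ∈ A ⊗ A / r₂`, the square
`(F ⊗ ι)(ι ⊗ G) = (ι ⊗ G)(F ⊗ ι)` in `A ⊗ A ⊗ A / (r₁, r₂)`. The intermediate elements `G(b ⊗ c)`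
and `F(a ⊗ b)` are represented by arbitrary `u`, `v` in `A ⊗ A`. -/
def LegsCommute {r₁ r₂ : Submodule ℂ (A ⊗[ℂ] A)}
    (F : A ⊗[ℂ] A →ₗ[ℂ] (A ⊗[ℂ] A) ⧸ r₁) (G : A ⊗[ℂ] A →ₗ[ℂ] (A ⊗[ℂ] A) ⧸ r₂) : Prop :=
  ∀ a b c : A, ∀ u v : A ⊗[ℂ] A,
    r₂.mkQ u = G (b ⊗ₜ[ℂ] c) → r₁.mkQ v = F (a ⊗ₜ[ℂ] b) →
    join12 r₁ r₂ (F.rTensor A ((TensorProduct.assoc ℂ A A A).symm (a ⊗ₜ[ℂ] u))) =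
      join23 r₁ r₂ (G.lTensor A (TensorProduct.assoc ℂ A A A (v ⊗ₜ[ℂ] c)))

/-! ### Solving `w · c = K c a b` for `w` -/

/-- If the operators `act c` on `Q` are jointly injective, and if for all `a, b` there is a
`w ∈ Q` with `act c w = K c a b` for all `c`, then this is the linear map `a ⊗ b ↦ w`. -/
noncomputable def solve {Q : Type*} [AddCommGroup Q] [Module ℂ Q] (act : A → Module.End ℂ Q)
    (nd : ∀ w, (∀ c, act c w = 0) → w = 0) (K : A → A →ₗ[ℂ] A →ₗ[ℂ] Q)
    (hK : ∀ a b, ∃ w, ∀ c, K c a b = act c w) : A ⊗[ℂ] A →ₗ[ℂ] Q :=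
  have key : ∀ w w', (∀ c, act c w = act c w') → w = w' := fun w w' h =>
    sub_eq_zero.1 (nd _ fun c => by rw [map_sub, h, sub_self])
  TensorProduct.lift (LinearMap.mk₂ ℂ (fun a b => (hK a b).choose)
    (fun a a' b => key _ _ fun c => by
      rw [map_add, ← (hK (a + a') b).choose_spec c, ← (hK a b).choose_spec c,
        ← (hK a' b).choose_spec c, map_add, LinearMap.add_apply])
    (fun r a b => key _ _ fun c => by
      rw [map_smul, ← (hK (r • a) b).choose_spec c, ← (hK a b).choose_spec c,
        map_smul, LinearMap.smul_apply])
    (fun a b b' => key _ _ fun c => by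
      rw [map_add, ← (hK a (b + b')).choose_spec c, ← (hK a b).choose_spec c,
        ← (hK a b').choose_spec c, map_add])
    (fun r a b => key _ _ fun c => by
      rw [map_smul, ← (hK a (r • b)).choose_spec c, ← (hK a b).choose_spec c, map_smul]))

theorem solve_spec {Q : Type*} [AddCommGroup Q] [Module ℂ Q] (act : A → Module.End ℂ Q)
    (nd : ∀ w, (∀ c, act c w = 0) → w = 0) (K : A → A →ₗ[ℂ] A →ₗ[ℂ] Q)
    (hK : ∀ a b, ∃ w, ∀ c, K c a b = act c w) (a b c : A) :
    act c (solve act nd K hK (a ⊗ₜ[ℂ] b)) = K c a b := by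
  simp only [solve, TensorProduct.lift.tmul, LinearMap.mk₂_apply]
  exact ((hK a b).choose_spec c).symm

/-! ### Left multiplier bialgebroids -/

section Left

variable {D : Type*} [NonUnitalRing D] [Module ℂ D] (s t : D →ₗ[ℂ] Mult A)

/-- The tensor product in which `s(x)a ⊗ b = a ⊗ t(x)b`. -/
abbrev LeftTensor := Bal (fun x => lm (s x)) (fun x => lm (t x))

/-- `w ↦ w(c ⊗ 1)`. -/
def LeftTensor.act1 (c : A) : Module.End ℂ (LeftTensor s t) :=
  Bal.map (LinearMap.mulRight ℂ c) LinearMap.id (by simp [lm_mul]) (by simp)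

/-- `w ↦ w(1 ⊗ c)`. -/
def LeftTensor.act2 (c : A) : Module.End ℂ (LeftTensor s t) :=
  Bal.map LinearMap.id (LinearMap.mulRight ℂ c) (by simp) (by simp [lm_mul])

/-- The target of a left comultiplication: the endomorphisms `T` of the tensor product
for which there are elements `T(a ⊗ 1)` and `T(1 ⊗ b)` of the tensor product with
`T(a ⊗ b) = (T(a ⊗ 1))(1 ⊗ b) = (T(1 ⊗ b))(a ⊗ 1)`. -/
def leftTakeuchi : Submodule ℂ (Module.End ℂ (LeftTensor s t)) where
  carrier := {T | (∀ a, ∃ w, ∀ b, T (Bal.mk _ _ a b) = LeftTensor.act2 s t b w) ∧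
    (∀ b, ∃ w, ∀ a, T (Bal.mk _ _ a b) = LeftTensor.act1 s t a w)}
  add_mem' := by
    rintro T T' ⟨h1, h2⟩ ⟨k1, k2⟩
    refine ⟨fun a => ?_, fun b => ?_⟩
    · obtain ⟨w, hw⟩ := h1 a
      obtain ⟨w', hw'⟩ := k1 a
      exact ⟨w + w', fun b => by rw [map_add, LinearMap.add_apply, hw, hw']⟩
    · obtain ⟨w, hw⟩ := h2 b
      obtain ⟨w', hw'⟩ := k2 b
      exact ⟨w + w', fun b => by rw [map_add, LinearMap.add_apply, hw, hw']⟩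
  zero_mem' := ⟨fun _ => ⟨0, by simp⟩, fun _ => ⟨0, by simp⟩⟩
  smul_mem' := by
    rintro r T ⟨h1, h2⟩
    refine ⟨fun a => ?_, fun b => ?_⟩
    · obtain ⟨w, hw⟩ := h1 a
      exact ⟨r • w, fun b => by rw [map_smul, LinearMap.smul_apply, hw]⟩
    · obtain ⟨w, hw⟩ := h2 b
      exact ⟨r • w, fun b => by rw [map_smul, LinearMap.smul_apply, hw]⟩

/-- The conditions on the algebras `A`, `D` and the maps `s`, `t` in a left multiplier
bialgebroid. -/
structure LeftBase : Prop where
  nondeg : ∀ a : A, (∀ b : A, a * b = 0) → a = 0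
  idem : Submodule.span ℂ {z : A | ∃ a b, z = a * b} = ⊤
  s_mul : ∀ x y, s (x * y) = s x * s y
  t_mul : ∀ x y, t (x * y) = t y * t x
  comm : ∀ x y, s x * t y = t y * s x
  s_faithful : Faith (fun x => lm (s x))
  t_faithful : Faith (fun x => lm (t x))
  s_idem : Idem (fun x => lm (s x))
  t_idem : Idem (fun x => lm (t x))
  nondeg1 : ∀ w, (∀ c, LeftTensor.act1 s t c w = 0) → w = 0
  nondeg2 : ∀ w, (∀ c, LeftTensor.act2 s t c w = 0) → w = 0

variable {s t}

theorem LeftBase.comm_apply (h : LeftBase s t) (x y : D) (a : A) :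
    lm (t y) (lm (s x) a) = lm (s x) (lm (t y) a) := by
  rw [← lm_mul_apply, ← lm_mul_apply, h.comm]

theorem LeftBase.comm_apply_r (h : LeftBase s t) (x y : D) (a : A) :
    rm (t y) (rm (s x) a) = rm (s x) (rm (t y) a) := by
  rw [← rm_mul_apply, ← rm_mul_apply, h.comm]

/-- Multiplication by `t(y) ⊗ s(x)` on the left. -/
def LeftBase.legs (h : LeftBase s t) (y x : D) : Module.End ℂ (LeftTensor s t) :=
  Bal.map (lm (t y)) (lm (s x)) (fun z a => h.comm_apply z y a)
    (fun z a => (h.comm_apply x z a).symm)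

/-- The map `a ⊗ b ↦ Δ(b)(a ⊗ 1)`. -/
noncomputable def LeftBase.tl (h : LeftBase s t) (Δ : A →ₗ[ℂ] leftTakeuchi s t) :
    A ⊗[ℂ] A →ₗ[ℂ] LeftTensor s t :=
  solve (LeftTensor.act2 s t) h.nondeg2
    (fun c => LinearMap.mk₂ ℂ (fun a b => (Δ b).1 (Bal.mk _ _ a c))
      (by simp) (by simp) (by simp) (by simp))
    (fun a b => (Δ b).2.1 a)

/-- The map `a ⊗ b ↦ Δ(a)(1 ⊗ b)`. -/
noncomputable def LeftBase.tr (h : LeftBase s t) (Δ : A →ₗ[ℂ] leftTakeuchi s t) :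
    A ⊗[ℂ] A →ₗ[ℂ] LeftTensor s t :=
  solve (LeftTensor.act1 s t) h.nondeg1
    (fun c => LinearMap.mk₂ ℂ (fun a b => (Δ a).1 (Bal.mk _ _ c b))
      (by simp) (by simp) (by simp) (by simp))
    (fun a b => (Δ a).2.2 b)

theorem LeftBase.tl_spec (h : LeftBase s t) (Δ : A →ₗ[ℂ] leftTakeuchi s t) (a b c : A) :
    LeftTensor.act2 s t c (h.tl Δ (a ⊗ₜ[ℂ] b)) = (Δ b).1 (Bal.mk _ _ a c) :=
  solve_spec _ _ _ _ a b c

theorem LeftBase.tr_spec (h : LeftBase s t) (Δ : A →ₗ[ℂ] leftTakeuchi s t) (a b c : A) :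
    LeftTensor.act1 s t c (h.tr Δ (a ⊗ₜ[ℂ] b)) = (Δ a).1 (Bal.mk _ _ c b) :=
  solve_spec _ _ _ _ a b c

variable (s t) in
/-- `(A, D, s, t, Δ)` is a left multiplier bialgebroid. -/
structure IsLeftMultiplierBialgebroid (Δ : A →ₗ[ℂ] leftTakeuchi s t) : Prop where
  base : LeftBase s t
  map_mul : ∀ a b, (Δ (a * b)).1 = (Δ a).1 ∘ₗ (Δ b).1
  /-- `Δ(s(x)t(y) a s(x')t(y')) = (t(y) ⊗ s(x)) Δ(a) (t(y') ⊗ s(x'))` -/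
  bimodule : ∀ (x y x' y' : D) (a : A),
    (Δ (lm (s x) (lm (t y) (rm (t y') (rm (s x') a))))).1 =
      base.legs y x ∘ₗ (Δ a).1 ∘ₗ base.legs y' x'
  /-- `(Δ ⊗ ι)(Δ(b)(1 ⊗ c))(a ⊗ 1 ⊗ 1) = (ι ⊗ Δ)(Δ(b)(a ⊗ 1))(1 ⊗ 1 ⊗ c)` -/
  coassoc : LegsCommute (base.tl Δ) (base.tr Δ)

/-- The slice map `φ ⊗ ι : a ⊗ b ↦ t(φ(a))b` for a morphism `φ` of left modules. -/
def LeftBase.slice1 (h : LeftBase s t) (φ : A →ₗ[ℂ] D) (hφ : ∀ x a, φ (lm (s x) a) = x * φ a) :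
    LeftTensor s t →ₗ[ℂ] A :=
  Bal.lift (LinearMap.mk₂ ℂ (fun a b => lm (t (φ a)) b)
      (by simp) (by simp) (by simp) (by simp))
    (fun x a b => by simp [hφ, h.t_mul, lm_mul_apply])

/-- The slice map `ι ⊗ ψ : a ⊗ b ↦ s(ψ(b))a` for a morphism `ψ` of right modules. -/
def LeftBase.slice2 (h : LeftBase s t) (ψ : A →ₗ[ℂ] D) (hψ : ∀ y a, ψ (lm (t y) a) = ψ a * y) :
    LeftTensor s t →ₗ[ℂ] A :=
  Bal.lift (LinearMap.mk₂ ℂ (fun a b => lm (s (ψ b)) a)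
      (by simp) (by simp) (by simp) (by simp))
    (fun x a b => by simp [hψ, h.s_mul, lm_mul_apply])

/-- `ε` is a left counit. -/
structure LeftBase.IsLeftCounit (h : LeftBase s t) (Δ : A →ₗ[ℂ] leftTakeuchi s t)
    (ε : A →ₗ[ℂ] D) : Prop where
  map_s : ∀ x a, ε (lm (s x) a) = x * ε a
  map_t : ∀ y a, ε (lm (t y) a) = ε a * y
  counit1 : ∀ a b : A, h.slice1 ε map_s (h.tr Δ (a ⊗ₜ[ℂ] b)) = a * b
  counit2 : ∀ a b : A, h.slice2 ε map_t (h.tl Δ (a ⊗ₜ[ℂ] b)) = b * a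

end Left

/-! ### Right multiplier bialgebroids -/

section Right

variable {D : Type*} [NonUnitalRing D] [Module ℂ D] (s t : D →ₗ[ℂ] Mult A)

/-- The tensor product in which `a t(y) ⊗ b = a ⊗ b s(y)`. -/
abbrev RightTensor := Bal (fun y => rm (t y)) (fun y => rm (s y))

/-- `w ↦ (c ⊗ 1)w`. -/
def RightTensor.act1 (c : A) : Module.End ℂ (RightTensor s t) :=
  Bal.map (LinearMap.mulLeft ℂ c) LinearMap.id (by simp [rm_mul]) (by simp)

/-- `w ↦ (1 ⊗ c)w`. -/
def RightTensor.act2 (c : A) : Module.End ℂ (RightTensor s t) :=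
  Bal.map LinearMap.id (LinearMap.mulLeft ℂ c) (by simp) (by simp [rm_mul])

/-- The target of a right comultiplication: the endomorphisms `w ↦ wT` (written here as
`w ↦ T w`) for which there are elements `(a ⊗ 1)T` and `(1 ⊗ b)T` of the tensor product with
`(a ⊗ b)T = (1 ⊗ b)((a ⊗ 1)T) = (a ⊗ 1)((1 ⊗ b)T)`. -/
def rightTakeuchi : Submodule ℂ (Module.End ℂ (RightTensor s t)) where
  carrier := {T | (∀ a, ∃ w, ∀ b, T (Bal.mk _ _ a b) = RightTensor.act2 s t b w) ∧
    (∀ b, ∃ w, ∀ a, T (Bal.mk _ _ a b) = RightTensor.act1 s t a w)}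
  add_mem' := by
    rintro T T' ⟨h1, h2⟩ ⟨k1, k2⟩
    refine ⟨fun a => ?_, fun b => ?_⟩
    · obtain ⟨w, hw⟩ := h1 a
      obtain ⟨w', hw'⟩ := k1 a
      exact ⟨w + w', fun b => by rw [map_add, LinearMap.add_apply, hw, hw']⟩
    · obtain ⟨w, hw⟩ := h2 b
      obtain ⟨w', hw'⟩ := k2 b
      exact ⟨w + w', fun b => by rw [map_add, LinearMap.add_apply, hw, hw']⟩
  zero_mem' := ⟨fun _ => ⟨0, by simp⟩, fun _ => ⟨0, by simp⟩⟩
  smul_mem' := by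
    rintro r T ⟨h1, h2⟩
    refine ⟨fun a => ?_, fun b => ?_⟩
    · obtain ⟨w, hw⟩ := h1 a
      exact ⟨r • w, fun b => by rw [map_smul, LinearMap.smul_apply, hw]⟩
    · obtain ⟨w, hw⟩ := h2 b
      exact ⟨r • w, fun b => by rw [map_smul, LinearMap.smul_apply, hw]⟩

/-- The conditions on the algebras `A`, `D` and the maps `s`, `t` in a right multiplier
bialgebroid. -/
structure RightBase : Prop where
  nondeg : ∀ a : A, (∀ b : A, b * a = 0) → a = 0
  idem : Submodule.span ℂ {z : A | ∃ a b, z = a * b} = ⊤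
  s_mul : ∀ x y, s (x * y) = s x * s y
  t_mul : ∀ x y, t (x * y) = t y * t x
  comm : ∀ x y, s x * t y = t y * s x
  s_faithful : Faith (fun x => rm (s x))
  t_faithful : Faith (fun x => rm (t x))
  s_idem : Idem (fun x => rm (s x))
  t_idem : Idem (fun x => rm (t x))
  nondeg1 : ∀ w, (∀ c, RightTensor.act1 s t c w = 0) → w = 0
  nondeg2 : ∀ w, (∀ c, RightTensor.act2 s t c w = 0) → w = 0

variable {s t}

theorem RightBase.comm_apply (h : RightBase s t) (x y : D) (a : A) :
    rm (t y) (rm (s x) a) = rm (s x) (rm (t y) a) := by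
  rw [← rm_mul_apply, ← rm_mul_apply, h.comm]

theorem RightBase.comm_apply_l (h : RightBase s t) (x y : D) (a : A) :
    lm (t y) (lm (s x) a) = lm (s x) (lm (t y) a) := by
  rw [← lm_mul_apply, ← lm_mul_apply, h.comm]

/-- Multiplication by `s(y) ⊗ t(x)` on the right. -/
def RightBase.legs (h : RightBase s t) (y x : D) : Module.End ℂ (RightTensor s t) :=
  Bal.map (rm (s y)) (rm (t x)) (fun z a => (h.comm_apply y z a).symm)
    (fun z a => h.comm_apply z x a)

/-- The map `a ⊗ b ↦ (a ⊗ 1)Δ(b)`. -/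
noncomputable def RightBase.lt (h : RightBase s t) (Δ : A →ₗ[ℂ] rightTakeuchi s t) :
    A ⊗[ℂ] A →ₗ[ℂ] RightTensor s t :=
  solve (RightTensor.act2 s t) h.nondeg2
    (fun c => LinearMap.mk₂ ℂ (fun a b => (Δ b).1 (Bal.mk _ _ a c))
      (by simp) (by simp) (by simp) (by simp))
    (fun a b => (Δ b).2.1 a)

/-- The map `a ⊗ b ↦ (1 ⊗ b)Δ(a)`. -/
noncomputable def RightBase.rt (h : RightBase s t) (Δ : A →ₗ[ℂ] rightTakeuchi s t) :
    A ⊗[ℂ] A →ₗ[ℂ] RightTensor s t :=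
  solve (RightTensor.act1 s t) h.nondeg1
    (fun c => LinearMap.mk₂ ℂ (fun a b => (Δ a).1 (Bal.mk _ _ c b))
      (by simp) (by simp) (by simp) (by simp))
    (fun a b => (Δ a).2.2 b)

theorem RightBase.lt_spec (h : RightBase s t) (Δ : A →ₗ[ℂ] rightTakeuchi s t) (a b c : A) :
    RightTensor.act2 s t c (h.lt Δ (a ⊗ₜ[ℂ] b)) = (Δ b).1 (Bal.mk _ _ a c) :=
  solve_spec _ _ _ _ a b c

theorem RightBase.rt_spec (h : RightBase s t) (Δ : A →ₗ[ℂ] rightTakeuchi s t) (a b c : A) :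
    RightTensor.act1 s t c (h.rt Δ (a ⊗ₜ[ℂ] b)) = (Δ a).1 (Bal.mk _ _ c b) :=
  solve_spec _ _ _ _ a b c

variable (s t) in
/-- `(A, D, s, t, Δ)` is a right multiplier bialgebroid. The endomorphisms `Δ(a)` act from the
right, so that products are compositions in the reverse order. -/
structure IsRightMultiplierBialgebroid (Δ : A →ₗ[ℂ] rightTakeuchi s t) : Prop where
  base : RightBase s t
  map_mul : ∀ a b, (Δ (a * b)).1 = (Δ b).1 ∘ₗ (Δ a).1
  /-- `Δ(s(y)t(x) a s(y')t(x')) = (s(y) ⊗ t(x)) Δ(a) (s(y') ⊗ t(x'))` -/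
  bimodule : ∀ (y x y' x' : D) (a : A),
    (Δ (lm (s y) (lm (t x) (rm (t x') (rm (s y') a))))).1 =
      base.legs y' x' ∘ₗ (Δ a).1 ∘ₗ base.legs y x
  /-- `(a ⊗ 1 ⊗ 1)((Δ ⊗ ι)((1 ⊗ c)Δ(b))) = (1 ⊗ 1 ⊗ c)((ι ⊗ Δ)((a ⊗ 1)Δ(b)))` -/
  coassoc : LegsCommute (base.lt Δ) (base.rt Δ)

/-- The slice map `φ ⊗ ι : a ⊗ b ↦ b s(φ(a))` for a morphism `φ` of left modules. -/
def RightBase.slice1 (h : RightBase s t) (φ : A →ₗ[ℂ] D)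
    (hφ : ∀ y a, φ (rm (t y) a) = y * φ a) : RightTensor s t →ₗ[ℂ] A :=
  Bal.lift (LinearMap.mk₂ ℂ (fun a b => rm (s (φ a)) b)
      (by simp) (by simp) (by simp) (by simp))
    (fun x a b => by simp [hφ, h.s_mul, rm_mul_apply])

/-- The slice map `ι ⊗ ψ : a ⊗ b ↦ a t(ψ(b))` for a morphism `ψ` of right modules. -/
def RightBase.slice2 (h : RightBase s t) (ψ : A →ₗ[ℂ] D)
    (hψ : ∀ y a, ψ (rm (s y) a) = ψ a * y) : RightTensor s t →ₗ[ℂ] A :=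
  Bal.lift (LinearMap.mk₂ ℂ (fun a b => rm (t (ψ b)) a)
      (by simp) (by simp) (by simp) (by simp))
    (fun x a b => by simp [hψ, h.t_mul, rm_mul_apply])

/-- `ε` is a right counit. -/
structure RightBase.IsRightCounit (h : RightBase s t) (Δ : A →ₗ[ℂ] rightTakeuchi s t)
    (ε : A →ₗ[ℂ] D) : Prop where
  map_s : ∀ y a, ε (rm (s y) a) = ε a * y
  map_t : ∀ x a, ε (rm (t x) a) = x * ε a
  counit1 : ∀ a b : A, h.slice1 ε map_t (h.rt Δ (a ⊗ₜ[ℂ] b)) = b * a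
  counit2 : ∀ a b : A, h.slice2 ε map_s (h.lt Δ (a ⊗ₜ[ℂ] b)) = a * b

end Right

/-! ### Multiplier bialgebroids -/

/-- The inclusion of a subalgebra of `M(A)`. -/
def incl (B : NonUnitalSubalgebra ℂ (Mult A)) : B →ₗ[ℂ] Mult A :=
  ((NonUnitalSubalgebraClass.subtype B : B →ₙₐ[ℂ] Mult A) : B →ₗ[ℂ] Mult A)

variable (A) in
/-- A multiplier bialgebroid `(A, B, C, S_B, S_C, Δ_B, Δ_C)`. -/
structure MultiplierBialgebroid where
  /-- the algebra `A` is non-degenerate and idempotent -/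
  nondeg_right : ∀ a : A, (∀ b : A, a * b = 0) → a = 0
  nondeg_left : ∀ a : A, (∀ b : A, b * a = 0) → a = 0
  idem : Submodule.span ℂ {z : A | ∃ a b, z = a * b} = ⊤
  /-- the base algebras -/
  B : NonUnitalSubalgebra ℂ (Mult A)
  C : NonUnitalSubalgebra ℂ (Mult A)
  /-- the anti-isomorphisms between the base algebras -/
  SB : B ≃ₗ[ℂ] C
  SB_mul : ∀ x x', SB (x * x') = SB x' * SB x
  SC : C ≃ₗ[ℂ] B
  SC_mul : ∀ y y', SC (y * y') = SC y' * SC y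
  /-- the left and the right comultiplication -/
  ΔB : A →ₗ[ℂ] leftTakeuchi (incl B) (incl C ∘ₗ SB.toLinearMap)
  ΔC : A →ₗ[ℂ] rightTakeuchi (incl C) (incl B ∘ₗ SC.toLinearMap)
  left : IsLeftMultiplierBialgebroid (incl B) (incl C ∘ₗ SB.toLinearMap) ΔB
  right : IsRightMultiplierBialgebroid (incl C) (incl B ∘ₗ SC.toLinearMap) ΔC
  /-- `((Δ_B ⊗ ι)((1 ⊗ c)Δ_C(b)))(a ⊗ 1 ⊗ 1) = (1 ⊗ 1 ⊗ c)((ι ⊗ Δ_C)(Δ_B(b)(a ⊗ 1)))` -/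
  mixed1 : LegsCommute (left.base.tl ΔB) (right.base.rt ΔC)
  /-- `(a ⊗ 1 ⊗ 1)((Δ_C ⊗ ι)(Δ_B(b)(1 ⊗ c))) = ((ι ⊗ Δ_B)((a ⊗ 1)Δ_C(b)))(1 ⊗ 1 ⊗ c)` -/
  mixed2 : LegsCommute (right.base.lt ΔC) (left.base.tr ΔB)

namespace MultiplierBialgebroid

variable (H : MultiplierBialgebroid A)

/-- `_BA ⊗ A^B`: the relations `xa ⊗ b = a ⊗ S_B(x)b`. -/
abbrev BA_AupB := LeftTensor (incl H.B) (incl H.C ∘ₗ H.SB.toLinearMap)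

/-- `^CA ⊗ A_C`: the relations `a S_C(y) ⊗ b = a ⊗ by`. -/
abbrev upCA_AC := RightTensor (incl H.C) (incl H.B ∘ₗ H.SC.toLinearMap)

/-- `A_B ⊗ _BA`: the relations `ax ⊗ b = a ⊗ xb`. -/
abbrev AB_BA := Bal (fun x => rm (incl H.B x)) (fun x => lm (incl H.B x))

/-- `A_C ⊗ _CA`: the relations `ay ⊗ b = a ⊗ yb`. -/
abbrev AC_CA := Bal (fun y => rm (incl H.C y)) (fun y => lm (incl H.C y))

/-- `_BA ⊗ A_B`: the relations `xa ⊗ b = a ⊗ bx`. -/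
abbrev BA_AB := Bal (fun x => lm (incl H.B x)) (fun x => rm (incl H.B x))

/-- `_CA ⊗ A_C`: the relations `ya ⊗ b = a ⊗ by`. -/
abbrev CA_AC := Bal (fun y => lm (incl H.C y)) (fun y => rm (incl H.C y))

/-- The elements `x y a x' y'` span `A`. -/
theorem hom_ext {X : Type*} [AddCommGroup X] [Module ℂ X] {F G : A →ₗ[ℂ] X}
    (h : ∀ (x x' : H.B) (y y' : H.C) (a : A),
      F (lm (incl H.B x) (lm (incl H.C y) (rm (incl H.C y') (rm (incl H.B x') a)))) =
        G (lm (incl H.B x) (lm (incl H.C y) (rm (incl H.C y') (rm (incl H.B x') a))))) :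
    F = G := by
  refine H.left.base.s_idem.hom_ext fun x a => ?_
  refine LinearMap.congr_fun (f := F ∘ₗ lm (incl H.B x)) (g := G ∘ₗ lm (incl H.B x)) ?_ a
  refine H.left.base.t_idem.hom_ext fun y a => ?_
  refine LinearMap.congr_fun
    (f := F ∘ₗ lm (incl H.B x) ∘ₗ lm (incl H.C (H.SB y)))
    (g := G ∘ₗ lm (incl H.B x) ∘ₗ lm (incl H.C (H.SB y))) ?_ a
  refine H.right.base.s_idem.hom_ext fun y' a => ?_
  refine LinearMap.congr_fun
    (f := F ∘ₗ lm (incl H.B x) ∘ₗ lm (incl H.C (H.SB y)) ∘ₗ rm (incl H.C y'))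
    (g := G ∘ₗ lm (incl H.B x) ∘ₗ lm (incl H.C (H.SB y)) ∘ₗ rm (incl H.C y')) ?_ a
  refine H.right.base.t_idem.hom_ext fun x' a => ?_
  exact h x (H.SC x') (H.SB y) y' a

theorem incl_mul (D : NonUnitalSubalgebra ℂ (Mult A)) (x x' : D) :
    incl D (x * x') = incl D x * incl D x' := rfl

theorem comm (x : H.B) (y : H.C) :
    incl H.B x * incl H.C y = incl H.C y * incl H.B x := by
  simpa using H.left.base.comm x (H.SB.symm y)

theorem comm_lm (x : H.B) (y : H.C) (a : A) :
    lm (incl H.B x) (lm (incl H.C y) a) = lm (incl H.C y) (lm (incl H.B x) a) := by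
  rw [← lm_mul_apply, ← lm_mul_apply, H.comm]

theorem comm_rm (x : H.B) (y : H.C) (a : A) :
    rm (incl H.B x) (rm (incl H.C y) a) = rm (incl H.C y) (rm (incl H.B x) a) := by
  rw [← rm_mul_apply, ← rm_mul_apply, H.comm]

theorem lm_rm (H : MultiplierBialgebroid A) (m n : Mult A) (a : A) :
    lm m (rm n a) = rm n (lm m a) :=
  MultHopf.lm_rm H.nondeg_left m n a

theorem ΔB_bimodule (x x' : H.B) (y y' : H.C) (a p q : A) :
    (H.ΔB (lm (incl H.B x) (lm (incl H.C y) (rm (incl H.C y') (rm (incl H.B x') a))))).1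
        (Bal.mk _ _ p q) =
      H.left.base.legs (H.SB.symm y) x
        ((H.ΔB a).1 (Bal.mk _ _ (lm (incl H.C y') p) (lm (incl H.B x') q))) := by
  have := LinearMap.congr_fun
    (H.left.bimodule x (H.SB.symm y) x' (H.SB.symm y') a) (Bal.mk _ _ p q)
  simpa [LeftBase.legs] using this

theorem ΔC_bimodule (x x' : H.B) (y y' : H.C) (a p q : A) :
    (H.ΔC (lm (incl H.B x) (lm (incl H.C y) (rm (incl H.C y') (rm (incl H.B x') a))))).1
        (Bal.mk _ _ p q) =
      H.right.base.legs y' (H.SC.symm x')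
        ((H.ΔC a).1 (Bal.mk _ _ (rm (incl H.C y) p) (rm (incl H.B x) q))) := by
  have := LinearMap.congr_fun
    (H.right.bimodule y (H.SC.symm x) y' (H.SC.symm x') a) (Bal.mk _ _ p q)
  rw [H.comm_lm, ← H.comm_rm]
  simpa [RightBase.legs] using this

theorem ΔB_rm_C (y : H.C) (b p q : A) :
    (H.ΔB (rm (incl H.C y) b)).1 (Bal.mk _ _ p q) =
      (H.ΔB b).1 (Bal.mk _ _ (lm (incl H.C y) p) q) := by
  refine LinearMap.congr_fun
    (f := LinearMap.applyₗ (Bal.mk _ _ p q) ∘ₗ Submodule.subtype _ ∘ₗ H.ΔB ∘ₗ rm (incl H.C y))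
    (g := LinearMap.applyₗ (Bal.mk _ _ (lm (incl H.C y) p) q) ∘ₗ Submodule.subtype _ ∘ₗ H.ΔB)
    (H.hom_ext fun x x' y1 y' a => ?_) b
  have e : rm (incl H.C y)
      (lm (incl H.B x) (lm (incl H.C y1) (rm (incl H.C y') (rm (incl H.B x') a)))) =
      lm (incl H.B x) (lm (incl H.C y1) (rm (incl H.C (y' * y)) (rm (incl H.B x') a))) := by
    rw [← H.lm_rm, ← H.lm_rm, ← rm_mul_apply, ← incl_mul]
  change (H.ΔB (rm (incl H.C y) _)).1 _ = (H.ΔB _).1 _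
  rw [e]
  refine (H.ΔB_bimodule x x' y1 (y' * y) a p q).trans ?_
  refine Eq.trans ?_ (H.ΔB_bimodule x x' y1 y' a (lm (incl H.C y) p) q).symm
  rw [incl_mul, lm_mul_apply]

theorem ΔB_rm_B (x : H.B) (b p q : A) :
    (H.ΔB (rm (incl H.B x) b)).1 (Bal.mk _ _ p q) =
      (H.ΔB b).1 (Bal.mk _ _ p (lm (incl H.B x) q)) := by
  refine LinearMap.congr_fun
    (f := LinearMap.applyₗ (Bal.mk _ _ p q) ∘ₗ Submodule.subtype _ ∘ₗ H.ΔB ∘ₗ rm (incl H.B x))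
    (g := LinearMap.applyₗ (Bal.mk _ _ p (lm (incl H.B x) q)) ∘ₗ Submodule.subtype _ ∘ₗ H.ΔB)
    (H.hom_ext fun x1 x' y1 y' a => ?_) b
  have e : rm (incl H.B x)
      (lm (incl H.B x1) (lm (incl H.C y1) (rm (incl H.C y') (rm (incl H.B x') a)))) =
      lm (incl H.B x1) (lm (incl H.C y1) (rm (incl H.C y') (rm (incl H.B (x' * x)) a))) := by
    rw [← H.lm_rm, ← H.lm_rm, H.comm_rm, incl_mul, rm_mul_apply]
  change (H.ΔB (rm (incl H.B x) _)).1 _ = (H.ΔB _).1 _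
  rw [e]
  refine (H.ΔB_bimodule x1 (x' * x) y1 y' a p q).trans ?_
  refine Eq.trans ?_ (H.ΔB_bimodule x1 x' y1 y' a p (lm (incl H.B x) q)).symm
  rw [incl_mul, lm_mul_apply]

theorem ΔC_lm_C (y : H.C) (b p q : A) :
    (H.ΔC (lm (incl H.C y) b)).1 (Bal.mk _ _ p q) =
      (H.ΔC b).1 (Bal.mk _ _ (rm (incl H.C y) p) q) := by
  refine LinearMap.congr_fun
    (f := LinearMap.applyₗ (Bal.mk _ _ p q) ∘ₗ Submodule.subtype _ ∘ₗ H.ΔC ∘ₗ lm (incl H.C y))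
    (g := LinearMap.applyₗ (Bal.mk _ _ (rm (incl H.C y) p) q) ∘ₗ Submodule.subtype _ ∘ₗ H.ΔC)
    (H.hom_ext fun x x' y1 y' a => ?_) b
  have e : lm (incl H.C y)
      (lm (incl H.B x) (lm (incl H.C y1) (rm (incl H.C y') (rm (incl H.B x') a)))) =
      lm (incl H.B x) (lm (incl H.C (y * y1)) (rm (incl H.C y') (rm (incl H.B x') a))) := by
    rw [← H.comm_lm, incl_mul, lm_mul_apply]
  change (H.ΔC (lm (incl H.C y) _)).1 _ = (H.ΔC _).1 _
  rw [e]
  refine (H.ΔC_bimodule x x' (y * y1) y' a p q).trans ?_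
  refine Eq.trans ?_ (H.ΔC_bimodule x x' y1 y' a (rm (incl H.C y) p) q).symm
  rw [incl_mul, rm_mul_apply]

theorem ΔC_lm_B (x : H.B) (b p q : A) :
    (H.ΔC (lm (incl H.B x) b)).1 (Bal.mk _ _ p q) =
      (H.ΔC b).1 (Bal.mk _ _ p (rm (incl H.B x) q)) := by
  refine LinearMap.congr_fun
    (f := LinearMap.applyₗ (Bal.mk _ _ p q) ∘ₗ Submodule.subtype _ ∘ₗ H.ΔC ∘ₗ lm (incl H.B x))
    (g := LinearMap.applyₗ (Bal.mk _ _ p (rm (incl H.B x) q)) ∘ₗ Submodule.subtype _ ∘ₗ H.ΔC)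
    (H.hom_ext fun x1 x' y1 y' a => ?_) b
  have e : lm (incl H.B x)
      (lm (incl H.B x1) (lm (incl H.C y1) (rm (incl H.C y') (rm (incl H.B x') a)))) =
      lm (incl H.B (x * x1)) (lm (incl H.C y1) (rm (incl H.C y') (rm (incl H.B x') a))) := by
    rw [incl_mul, lm_mul_apply]
  change (H.ΔC (lm (incl H.B x) _)).1 _ = (H.ΔC _).1 _
  rw [e]
  refine (H.ΔC_bimodule (x * x1) x' y1 y' a p q).trans ?_
  refine Eq.trans ?_ (H.ΔC_bimodule x1 x' y1 y' a p (rm (incl H.B x) q)).symm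
  rw [incl_mul, rm_mul_apply]

/-! ### The canonical maps -/

/-- `T_λ : _CA ⊗ A_C → _BA ⊗ A^B`, `a ⊗ b ↦ Δ_B(b)(a ⊗ 1)`. The domain is `A^B ⊗ ^BA`, with the
relations `S_B(x)a ⊗ b = a ⊗ bS_B(x)`, since `S_B(B) = C`. -/
noncomputable def Tl : H.CA_AC →ₗ[ℂ] H.BA_AupB :=
  Bal.desc (H.left.base.tl H.ΔB) (fun y a b => by
    rw [← sub_eq_zero]
    refine H.left.base.nondeg2 _ fun c => ?_
    rw [map_sub, LeftBase.tl_spec, LeftBase.tl_spec, H.ΔB_rm_C, sub_self])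

/-- `T_ρ : A_B ⊗ _BA → _BA ⊗ A^B`, `a ⊗ b ↦ Δ_B(a)(1 ⊗ b)`. -/
noncomputable def Tr : H.AB_BA →ₗ[ℂ] H.BA_AupB :=
  Bal.desc (H.left.base.tr H.ΔB) (fun x a b => by
    rw [← sub_eq_zero]
    refine H.left.base.nondeg1 _ fun c => ?_
    rw [map_sub, LeftBase.tr_spec, LeftBase.tr_spec, H.ΔB_rm_B, sub_self])

/-- `_λT : A_C ⊗ _CA → ^CA ⊗ A_C`, `a ⊗ b ↦ (a ⊗ 1)Δ_C(b)`. -/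
noncomputable def lT : H.AC_CA →ₗ[ℂ] H.upCA_AC :=
  Bal.desc (H.right.base.lt H.ΔC) (fun y a b => by
    rw [← sub_eq_zero]
    refine H.right.base.nondeg2 _ fun c => ?_
    rw [map_sub, RightBase.lt_spec, RightBase.lt_spec, H.ΔC_lm_C, sub_self])

/-- `_ρT : _BA ⊗ A_B → ^CA ⊗ A_C`, `a ⊗ b ↦ (1 ⊗ b)Δ_C(a)`. The domain is `A^C ⊗ ^CA`, with the
relations `S_C(y)a ⊗ b = a ⊗ bS_C(y)`, since `S_C(C) = B`. -/
noncomputable def rT : H.BA_AB →ₗ[ℂ] H.upCA_AC :=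
  Bal.desc (H.right.base.rt H.ΔC) (fun x a b => by
    rw [← sub_eq_zero]
    refine H.right.base.nondeg1 _ fun c => ?_
    rw [map_sub, RightBase.rt_spec, RightBase.rt_spec, H.ΔC_lm_B, sub_self])

/-! ### Regular multiplier Hopf algebroids -/

/-- The span `_BI` of all `ω(a)` with `ω ∈ Hom(_BA, _BB)`. -/
def BI : Submodule ℂ H.B :=
  Submodule.span ℂ {z | ∃ ω : A →ₗ[ℂ] H.B,
    (∀ x a, ω (lm (incl H.B x) a) = x * ω a) ∧ ∃ a, z = ω a}

/-- The span `I^B` of all `ω(a)` with `ω ∈ Hom(A^B, B_B)`. -/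
def IupB : Submodule ℂ H.B :=
  Submodule.span ℂ {z | ∃ ω : A →ₗ[ℂ] H.B,
    (∀ x a, ω (lm (incl H.C (H.SB x)) a) = ω a * x) ∧ ∃ a, z = ω a}

/-- The span `I_C` of all `ω(a)` with `ω ∈ Hom(A_C, C_C)`. -/
def IC : Submodule ℂ H.C :=
  Submodule.span ℂ {z | ∃ ω : A →ₗ[ℂ] H.C,
    (∀ y a, ω (rm (incl H.C y) a) = ω a * y) ∧ ∃ a, z = ω a}

/-- The span `^CI` of all `ω(a)` with `ω ∈ Hom(^CA, _CC)`. -/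
def upCI : Submodule ℂ H.C :=
  Submodule.span ℂ {z | ∃ ω : A →ₗ[ℂ] H.C,
    (∀ y a, ω (rm (incl H.B (H.SC y)) a) = y * ω a) ∧ ∃ a, z = ω a}

/-- `H` is a regular multiplier Hopf algebroid. -/
structure IsRegularHopf : Prop where
  /-- `S_B(_BI) A = A` -/
  full1 : Idem (fun x : H.BI => lm (incl H.C (H.SB x.1)))
  /-- `I^B A = A` -/
  full2 : Idem (fun x : H.IupB => lm (incl H.B x.1))
  /-- `A S_C(I_C) = A` -/
  full3 : Idem (fun y : H.IC => rm (incl H.B (H.SC y.1)))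
  /-- `A ^CI = A` -/
  full4 : Idem (fun y : H.upCI => rm (incl H.C y.1))
  bij_Tl : Function.Bijective H.Tl
  bij_Tr : Function.Bijective H.Tr
  bij_lT : Function.Bijective H.lT
  bij_rT : Function.Bijective H.rT

namespace IsRegularHopf

variable {H}

/-- `T_λ⁻¹` -/
noncomputable def TlInv (hH : H.IsRegularHopf) : H.BA_AupB →ₗ[ℂ] H.CA_AC :=
  (LinearEquiv.ofBijective H.Tl hH.bij_Tl).symm.toLinearMap

/-- `T_ρ⁻¹` -/
noncomputable def TrInv (hH : H.IsRegularHopf) : H.BA_AupB →ₗ[ℂ] H.AB_BA :=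
  (LinearEquiv.ofBijective H.Tr hH.bij_Tr).symm.toLinearMap

/-- `_λT⁻¹` -/
noncomputable def lTInv (hH : H.IsRegularHopf) : H.upCA_AC →ₗ[ℂ] H.AC_CA :=
  (LinearEquiv.ofBijective H.lT hH.bij_lT).symm.toLinearMap

/-- `_ρT⁻¹` -/
noncomputable def rTInv (hH : H.IsRegularHopf) : H.upCA_AC →ₗ[ℂ] H.BA_AB :=
  (LinearEquiv.ofBijective H.rT hH.bij_rT).symm.toLinearMap

end IsRegularHopf

/-! ### Antipodes -/

/-- An anti-automorphism `S` of `A` with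
`S(x y a x' y') = S_C(y') S_B(x') S(a) S_C(y) S_B(x)`. -/
structure AntiAut where
  /-- the underlying linear bijection -/
  S : A ≃ₗ[ℂ] A
  S_mul : ∀ a b, S (a * b) = S b * S a
  bimodule : ∀ (x x' : H.B) (y y' : H.C) (a : A),
    S (lm (incl H.B x) (lm (incl H.C y) (rm (incl H.C y') (rm (incl H.B x') a)))) =
      lm (incl H.B (H.SC y')) (lm (incl H.C (H.SB x'))
        (rm (incl H.C (H.SB x)) (rm (incl H.B (H.SC y)) (S a))))

namespace AntiAut

variable {H} (S : H.AntiAut)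

theorem lm_B (x : H.B) (a : A) :
    S.S (lm (incl H.B x) a) = rm (incl H.C (H.SB x)) (S.S a) := by
  refine LinearMap.congr_fun (f := S.S.toLinearMap ∘ₗ lm (incl H.B x))
    (g := rm (incl H.C (H.SB x)) ∘ₗ S.S.toLinearMap) (H.hom_ext fun x1 x' y1 y' a => ?_) a
  simp only [LinearMap.comp_apply, LinearEquiv.coe_coe]
  rw [← lm_mul_apply, ← incl_mul, S.bimodule, S.bimodule, H.SB_mul, incl_mul, rm_mul_apply,
    H.lm_rm, H.lm_rm]

theorem lm_C (y : H.C) (a : A) :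
    S.S (lm (incl H.C y) a) = rm (incl H.B (H.SC y)) (S.S a) := by
  refine LinearMap.congr_fun (f := S.S.toLinearMap ∘ₗ lm (incl H.C y))
    (g := rm (incl H.B (H.SC y)) ∘ₗ S.S.toLinearMap) (H.hom_ext fun x1 x' y1 y' a => ?_) a
  simp only [LinearMap.comp_apply, LinearEquiv.coe_coe]
  rw [← H.comm_lm, ← lm_mul_apply (incl H.C y), ← incl_mul, S.bimodule, S.bimodule, H.SC_mul,
    incl_mul, rm_mul_apply, ← H.comm_rm, H.lm_rm, H.lm_rm]

theorem rm_B (x : H.B) (a : A) :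
    S.S (rm (incl H.B x) a) = lm (incl H.C (H.SB x)) (S.S a) := by
  refine LinearMap.congr_fun (f := S.S.toLinearMap ∘ₗ rm (incl H.B x))
    (g := lm (incl H.C (H.SB x)) ∘ₗ S.S.toLinearMap) (H.hom_ext fun x1 x' y1 y' a => ?_) a
  simp only [LinearMap.comp_apply, LinearEquiv.coe_coe]
  rw [← H.lm_rm, ← H.lm_rm, H.comm_rm, ← rm_mul_apply (incl H.B x'), ← incl_mul, S.bimodule,
    S.bimodule, H.SB_mul, incl_mul, lm_mul_apply, H.comm_lm]

theorem rm_C (y : H.C) (a : A) :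
    S.S (rm (incl H.C y) a) = lm (incl H.B (H.SC y)) (S.S a) := by
  refine LinearMap.congr_fun (f := S.S.toLinearMap ∘ₗ rm (incl H.C y))
    (g := lm (incl H.B (H.SC y)) ∘ₗ S.S.toLinearMap) (H.hom_ext fun x1 x' y1 y' a => ?_) a
  simp only [LinearMap.comp_apply, LinearEquiv.coe_coe]
  rw [← H.lm_rm, ← H.lm_rm, ← rm_mul_apply, ← incl_mul, S.bimodule, S.bimodule, H.SC_mul,
    incl_mul, lm_mul_apply]

/-- `m_C(S ⊗ ι) : _BA ⊗ A^B → A`, `a ⊗ b ↦ S(a)b`. -/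
noncomputable def mS1 : H.BA_AupB →ₗ[ℂ] A :=
  Bal.lift ((LinearMap.mul ℂ A).compl₁₂ S.S.toLinearMap LinearMap.id)
    (fun x a b => by simp [S.lm_B, mul_lm])

/-- `m_B(ι ⊗ S) : ^CA ⊗ A_C → A`, `a ⊗ b ↦ aS(b)`. -/
noncomputable def mS2 : H.upCA_AC →ₗ[ℂ] A :=
  Bal.lift ((LinearMap.mul ℂ A).compl₁₂ LinearMap.id S.S.toLinearMap)
    (fun y a b => by simp [S.rm_C, mul_lm])

end AntiAut

/-- An invertible antipode of `H`. -/
structure InvertibleAntipode extends H.AntiAut where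
  /-- There are a left and a right counit `ε_B`, `ε_C` such that
  `m_C(S ⊗ ι)T_ρ(a ⊗ b) = S_C(ε_C(a))b` and `m_B(ι ⊗ S)_λT(a ⊗ b) = aS_B(ε_B(b))`. -/
  antipode : ∃ (εB : A →ₗ[ℂ] H.B) (εC : A →ₗ[ℂ] H.C),
    H.left.base.IsLeftCounit H.ΔB εB ∧ H.right.base.IsRightCounit H.ΔC εC ∧
    (∀ a b : A, toAntiAut.mS1 (H.Tr (Bal.mk _ _ a b)) = lm (incl H.B (H.SC (εC a))) b) ∧
    (∀ a b : A, toAntiAut.mS2 (H.lT (Bal.mk _ _ a b)) = rm (incl H.C (H.SB (εB b))) a)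

/-! ### Flips and the maps induced by the antipode -/

/-- `Σ : A_C ⊗ _CA → _CA ⊗ A_C`, `a ⊗ b ↦ b ⊗ a`. -/
noncomputable def flipC : H.AC_CA →ₗ[ℂ] H.CA_AC :=
  Bal.lift (Bal.mk _ _).flip (fun y a b => by
    simpa using (Bal.mk_bal (fun y => lm (incl H.C y)) (fun y => rm (incl H.C y)) y b a).symm)

/-- `Σ : A_B ⊗ _BA → _BA ⊗ A_B`, `a ⊗ b ↦ b ⊗ a`. -/
noncomputable def flipB : H.AB_BA →ₗ[ℂ] H.BA_AB :=
  Bal.lift (Bal.mk _ _).flip (fun x a b => by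
    simpa using (Bal.mk_bal (fun x => lm (incl H.B x)) (fun x => rm (incl H.B x)) x b a).symm)

namespace AntiAut

variable {H} (S : H.AntiAut)

/-- `(S ⊗ ι)Σ : A_C ⊗ _CA → ^CA ⊗ A_C`, `a ⊗ b ↦ S(b) ⊗ a`. -/
noncomputable def flipS1 : H.AC_CA →ₗ[ℂ] H.upCA_AC :=
  Bal.lift ((Bal.mk _ _).compl₁₂ S.S.toLinearMap LinearMap.id).flip (fun y a b => by
    simpa [S.lm_C] using (Bal.mk_bal (fun y => rm (incl H.B (H.SC y)))
      (fun y => rm (incl H.C y)) y (S.S b) a).symm)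

/-- `(S ⊗ ι)Σ : ^CA ⊗ A_C → _BA ⊗ A_B`, `a ⊗ b ↦ S(b) ⊗ a`. -/
noncomputable def flipS2 : H.upCA_AC →ₗ[ℂ] H.BA_AB :=
  Bal.lift ((Bal.mk _ _).compl₁₂ S.S.toLinearMap LinearMap.id).flip (fun y a b => by
    simpa [S.rm_C] using (Bal.mk_bal (fun x => lm (incl H.B x))
      (fun x => rm (incl H.B x)) (H.SC y) (S.S b) a).symm)

/-- `(ι ⊗ S)Σ : A_B ⊗ _BA → _BA ⊗ A^B`, `a ⊗ b ↦ b ⊗ S(a)`. -/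
noncomputable def flipS3 : H.AB_BA →ₗ[ℂ] H.BA_AupB :=
  Bal.lift ((Bal.mk _ _).compl₁₂ LinearMap.id S.S.toLinearMap).flip (fun x a b => by
    simpa [S.rm_B] using (Bal.mk_bal (fun x => lm (incl H.B x))
      (fun x => lm (incl H.C (H.SB x))) x b (S.S a)).symm)

/-- `(ι ⊗ S)Σ : _BA ⊗ A^B → _CA ⊗ A_C`, `a ⊗ b ↦ b ⊗ S(a)`. -/
noncomputable def flipS4 : H.BA_AupB →ₗ[ℂ] H.CA_AC :=
  Bal.lift ((Bal.mk _ _).compl₁₂ LinearMap.id S.S.toLinearMap).flip (fun x a b => by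
    simpa [S.lm_B] using (Bal.mk_bal (fun y => lm (incl H.C y))
      (fun y => rm (incl H.C y)) (H.SB x) b (S.S a)).symm)

/-- `ι ⊗ S : ^CA ⊗ A_C → A_B ⊗ _BA`, `a ⊗ b ↦ a ⊗ S(b)`. -/
noncomputable def idS : H.upCA_AC →ₗ[ℂ] H.AB_BA :=
  Bal.lift ((Bal.mk _ _).compl₁₂ LinearMap.id S.S.toLinearMap) (fun y a b => by
    simpa [S.rm_C] using (Bal.mk_bal (fun x => rm (incl H.B x))
      (fun x => lm (incl H.B x)) (H.SC y) a (S.S b)))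

end AntiAut

end MultiplierBialgebroid

end MultHopf

/-! Write both Δ_B(b) and Δ_C(b) formally as b₁ ⊗ b₂. Everything rests on two inversion formulas, in
which the antipode undoes a canonical map: `Tr_idS_rT`, that is Δ_B(b₁)(1 ⊗ S(b₂)S(c)) = b ⊗ S(c),
and `lT_sId_Tl`, that is (S(a)S(b₁) ⊗ 1)Δ_C(b₂) = S(a) ⊗ b. Both come from contracting the first
mixed co-associativity condition: two adjacent legs are merged by ι ⊗ m(ι ⊗ S), respectively m(S ⊗
ι) ⊗ ι, the antipode axiom turns the merged legs into a counit, the balancing relation moves the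
counit to the other leg, and the counit axiom removes it.

Multiplicativity of the comultiplications then gives one triangle of each square, free of inverses:
Δ_B(ab₁)(1 ⊗ S(b₂)) = Δ_B(a)(b ⊗ 1) is `Tr_idS_lT`, and (S(a₁) ⊗ 1)Δ_C(a₂b) = (1 ⊗ a)Δ_C(b) is
`lT_sId_Tr`. The other two triangles (`rT_flipS2_lT`, `Tl_flipS4_Tr`) follow formally: the two
identities just found combine to replace a composite of canonical maps by one to which an inversion
formula applies.

Since A need not have a unit, these formulas make sense only with some leg covered by an element of
A. Most comparisons are therefore made after one more multiplication, which non-degeneracy cancels.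
-/

namespace MultHopf

open scoped TensorProduct

section

variable {A : Type*} [NonUnitalRing A] [Module ℂ A] [IsScalarTower ℂ A A] [SMulCommClass ℂ A A]

/-! ### Contracting co-associativity conditions on threefold tensor products. -/

/-- The linear map on the threefold balanced tensor product with values
`L₁ (p ⊗ q) r = L₂ p (q ⊗ r)`. -/
def tripleLift {X : Type*} [AddCommGroup X] [Module ℂ X] {r₁ r₂ : Submodule ℂ (A ⊗[ℂ] A)}
    (L₁ : (A ⊗[ℂ] A) ⧸ r₁ →ₗ[ℂ] A →ₗ[ℂ] X) (L₂ : A →ₗ[ℂ] (A ⊗[ℂ] A) ⧸ r₂ →ₗ[ℂ] X)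
    (h : ∀ p q r, L₁ (r₁.mkQ (p ⊗ₜ[ℂ] q)) r = L₂ p (r₂.mkQ (q ⊗ₜ[ℂ] r))) :
    Triple r₁ r₂ →ₗ[ℂ] X :=
  Submodule.liftQ _ (TensorProduct.lift (L₂.compl₂ r₂.mkQ)) (by
    refine sup_le (Submodule.span_le.2 ?_) (Submodule.span_le.2 ?_)
    · rintro _ ⟨u, hu, c, rfl⟩
      -- The map is built from L₂, so the relations `r₂` vanish at once. By `h` it also factors
      -- through L₁, which kills `r₁`.
      have key : TensorProduct.lift (L₂.compl₂ r₂.mkQ) ∘ₗ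
          (TensorProduct.assoc ℂ A A A).toLinearMap =
          TensorProduct.lift (L₁ ∘ₗ r₁.mkQ) := by
        ext p q r
        simpa using (h p q r).symm
      have := LinearMap.congr_fun key (u ⊗ₜ[ℂ] c)
      have hu' : r₁.mkQ u = 0 := (Submodule.Quotient.mk_eq_zero _).2 hu
      simp only [LinearMap.comp_apply, LinearEquiv.coe_coe, TensorProduct.lift.tmul, hu',
        map_zero, LinearMap.zero_apply] at this
      exact this
    · rintro _ ⟨a, u, hu, rfl⟩
      have hu' : r₂.mkQ u = 0 := (Submodule.Quotient.mk_eq_zero _).2 hu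
      simp only [SetLike.mem_coe, LinearMap.mem_ker, TensorProduct.lift.tmul,
        LinearMap.compl₂_apply, hu', map_zero])

theorem tripleLift_join23 {X : Type*} [AddCommGroup X] [Module ℂ X]
    {r₁ r₂ : Submodule ℂ (A ⊗[ℂ] A)}
    (L₁ : (A ⊗[ℂ] A) ⧸ r₁ →ₗ[ℂ] A →ₗ[ℂ] X) (L₂ : A →ₗ[ℂ] (A ⊗[ℂ] A) ⧸ r₂ →ₗ[ℂ] X)
    (h : ∀ p q r, L₁ (r₁.mkQ (p ⊗ₜ[ℂ] q)) r = L₂ p (r₂.mkQ (q ⊗ₜ[ℂ] r))) (p : A)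
    (w : (A ⊗[ℂ] A) ⧸ r₂) :
    tripleLift L₁ L₂ h (join23 r₁ r₂ (p ⊗ₜ[ℂ] w)) = L₂ p w := by
  obtain ⟨u, rfl⟩ := r₂.mkQ_surjective w
  rfl

theorem tripleLift_join12 {X : Type*} [AddCommGroup X] [Module ℂ X]
    {r₁ r₂ : Submodule ℂ (A ⊗[ℂ] A)}
    (L₁ : (A ⊗[ℂ] A) ⧸ r₁ →ₗ[ℂ] A →ₗ[ℂ] X) (L₂ : A →ₗ[ℂ] (A ⊗[ℂ] A) ⧸ r₂ →ₗ[ℂ] X)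
    (h : ∀ p q r, L₁ (r₁.mkQ (p ⊗ₜ[ℂ] q)) r = L₂ p (r₂.mkQ (q ⊗ₜ[ℂ] r)))
    (w : (A ⊗[ℂ] A) ⧸ r₁) (r : A) :
    tripleLift L₁ L₂ h (join12 r₁ r₂ (w ⊗ₜ[ℂ] r)) = L₁ w r := by
  obtain ⟨u, rfl⟩ := r₁.mkQ_surjective w
  induction u with
  | zero => simp
  | add u v hu hv => simp only [map_add, TensorProduct.add_tmul, hu, hv, LinearMap.add_apply]
  | tmul p q => exact (h p q r).symm

/-- Evaluation of a coassociativity condition through a map out of the threefold tensor product. -/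
theorem LegsCommute.eval {I J X : Type*} [AddCommGroup X] [Module ℂ X]
    {f g : I → Module.End ℂ A} {f' g' : J → Module.End ℂ A}
    {F : A ⊗[ℂ] A →ₗ[ℂ] Bal f g} {G : A ⊗[ℂ] A →ₗ[ℂ] Bal f' g'} (hFG : LegsCommute F G)
    (L₁ : Bal f g →ₗ[ℂ] A →ₗ[ℂ] X) (L₂ : A →ₗ[ℂ] Bal f' g' →ₗ[ℂ] X)
    (h : ∀ p q r, L₁ (Bal.mk f g p q) r = L₂ p (Bal.mk f' g' q r))
    {a c : A} {Φ : Bal f' g' →ₗ[ℂ] X} {Ψ : Bal f g →ₗ[ℂ] X}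
    (hΦ : ∀ p r, Φ (Bal.mk f' g' p r) = L₁ (F (a ⊗ₜ[ℂ] p)) r)
    (hΨ : ∀ p q, Ψ (Bal.mk f g p q) = L₂ p (G (q ⊗ₜ[ℂ] c))) (b : A) :
    Φ (G (b ⊗ₜ[ℂ] c)) = Ψ (F (a ⊗ₜ[ℂ] b)) := by
  obtain ⟨u, hu⟩ := (balRel f' g').mkQ_surjective (G (b ⊗ₜ[ℂ] c))
  -- The condition holds for all representatives of the two intermediate elements, so any choice
  -- serves. With a and c fixed, both contracted sides depend only on the classes of u and v; this
  -- is what Φ and Ψ record.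
  obtain ⟨v, hv⟩ := (balRel f g).mkQ_surjective (F (a ⊗ₜ[ℂ] b))
  have key := congrArg (tripleLift L₁ L₂ h) (hFG a b c u v hu hv)
  have e₁ : ∀ u : A ⊗[ℂ] A, tripleLift L₁ L₂ h (join12 (balRel f g) (balRel f' g')
      (F.rTensor A ((TensorProduct.assoc ℂ A A A).symm (a ⊗ₜ[ℂ] u)))) =
      Φ ((balRel f' g').mkQ u) := fun u => by
    induction u with
    | zero => simp
    | add u v hu hv => simp only [map_add, TensorProduct.tmul_add, hu, hv]
    | tmul p r =>
      exact (tripleLift_join12 L₁ L₂ h (F (a ⊗ₜ[ℂ] p)) r).trans (hΦ p r).symm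
  have e₂ : ∀ v : A ⊗[ℂ] A, tripleLift L₁ L₂ h (join23 (balRel f g) (balRel f' g')
      (G.lTensor A (TensorProduct.assoc ℂ A A A (v ⊗ₜ[ℂ] c)))) =
      Ψ ((balRel f g).mkQ v) := fun v => by
    induction v with
    | zero => simp
    | add u v hu hv => simp only [map_add, TensorProduct.add_tmul, hu, hv]
    | tmul p q =>
      exact (tripleLift_join23 L₁ L₂ h p (G (q ⊗ₜ[ℂ] c))).trans (hΨ p q).symm
  rw [e₁, e₂, hu, hv] at key
  exact key

/-! ### Multiplication by elements of A on the legs of balanced tensor products. -/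

section

variable {D : Type*} [NonUnitalRing D] [Module ℂ D] {s t : D →ₗ[ℂ] Mult A}

@[simp] theorem LeftTensor.act1_mk (c a b : A) :
    LeftTensor.act1 s t c (Bal.mk _ _ a b) = Bal.mk _ _ (a * c) b :=
  Bal.map_mk _ _ _ _ _ _

@[simp] theorem LeftTensor.act2_mk (c a b : A) :
    LeftTensor.act2 s t c (Bal.mk _ _ a b) = Bal.mk _ _ a (b * c) :=
  Bal.map_mk _ _ _ _ _ _

@[simp] theorem RightTensor.act1_mk (c a b : A) :
    RightTensor.act1 s t c (Bal.mk _ _ a b) = Bal.mk _ _ (c * a) b :=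
  Bal.map_mk _ _ _ _ _ _

@[simp] theorem RightTensor.act2_mk (c a b : A) :
    RightTensor.act2 s t c (Bal.mk _ _ a b) = Bal.mk _ _ a (c * b) :=
  Bal.map_mk _ _ _ _ _ _

variable (s t) in
/-- `w ↦ w(1 ⊗ c)`, linearly in `c`. -/
def LeftTensor.act2ₗ : LeftTensor s t →ₗ[ℂ] A →ₗ[ℂ] LeftTensor s t :=
  LinearMap.mk₂ ℂ (fun w c => LeftTensor.act2 s t c w) (by simp) (by simp)
    (fun w c c' => LinearMap.congr_fun (f := LeftTensor.act2 s t (c + c'))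
      (g := LeftTensor.act2 s t c + LeftTensor.act2 s t c')
      (Bal.hom_ext fun a b => by simp [mul_add]) w)
    (fun r w c => LinearMap.congr_fun (f := LeftTensor.act2 s t (r • c))
      (g := r • LeftTensor.act2 s t c) (Bal.hom_ext fun a b => by simp [mul_smul_comm]) w)

variable (s t) in
/-- `w ↦ (c ⊗ 1)w`, linearly in `c`. -/
def RightTensor.act1ₗ : A →ₗ[ℂ] RightTensor s t →ₗ[ℂ] RightTensor s t :=
  LinearMap.mk₂ ℂ (fun c w => RightTensor.act1 s t c w)
    (fun c c' w => LinearMap.congr_fun (f := RightTensor.act1 s t (c + c'))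
      (g := RightTensor.act1 s t c + RightTensor.act1 s t c')
      (Bal.hom_ext fun a b => by simp [add_mul]) w)
    (fun r c w => LinearMap.congr_fun (f := RightTensor.act1 s t (r • c))
      (g := r • RightTensor.act1 s t c) (Bal.hom_ext fun a b => by simp [smul_mul_assoc]) w)
    (by simp) (by simp)

theorem LeftTensor.act1_act1 (c d : A) (w : LeftTensor s t) :
    LeftTensor.act1 s t d (LeftTensor.act1 s t c w) = LeftTensor.act1 s t (c * d) w :=
  LinearMap.congr_fun (f := LeftTensor.act1 s t d ∘ₗ LeftTensor.act1 s t c)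
    (Bal.hom_ext fun a b => by simp [mul_assoc]) w

theorem LeftTensor.act2_act2 (c d : A) (w : LeftTensor s t) :
    LeftTensor.act2 s t d (LeftTensor.act2 s t c w) = LeftTensor.act2 s t (c * d) w :=
  LinearMap.congr_fun (f := LeftTensor.act2 s t d ∘ₗ LeftTensor.act2 s t c)
    (Bal.hom_ext fun a b => by simp [mul_assoc]) w

theorem LeftTensor.act1_act2 (c d : A) (w : LeftTensor s t) :
    LeftTensor.act1 s t d (LeftTensor.act2 s t c w) =
      LeftTensor.act2 s t c (LeftTensor.act1 s t d w) :=
  LinearMap.congr_fun (f := LeftTensor.act1 s t d ∘ₗ LeftTensor.act2 s t c)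
    (g := LeftTensor.act2 s t c ∘ₗ LeftTensor.act1 s t d)
    (Bal.hom_ext fun a b => by simp) w

theorem RightTensor.act1_act1 (c d : A) (w : RightTensor s t) :
    RightTensor.act1 s t d (RightTensor.act1 s t c w) = RightTensor.act1 s t (d * c) w :=
  LinearMap.congr_fun (f := RightTensor.act1 s t d ∘ₗ RightTensor.act1 s t c)
    (Bal.hom_ext fun a b => by simp [mul_assoc]) w

theorem RightTensor.act2_act2 (c d : A) (w : RightTensor s t) :
    RightTensor.act2 s t d (RightTensor.act2 s t c w) = RightTensor.act2 s t (d * c) w :=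
  LinearMap.congr_fun (f := RightTensor.act2 s t d ∘ₗ RightTensor.act2 s t c)
    (Bal.hom_ext fun a b => by simp [mul_assoc]) w

theorem RightTensor.act2_act1 (c d : A) (w : RightTensor s t) :
    RightTensor.act2 s t d (RightTensor.act1 s t c w) =
      RightTensor.act1 s t c (RightTensor.act2 s t d w) :=
  LinearMap.congr_fun (f := RightTensor.act2 s t d ∘ₗ RightTensor.act1 s t c)
    (g := RightTensor.act1 s t c ∘ₗ RightTensor.act2 s t d)
    (Bal.hom_ext fun a b => by simp) w

/-- Non-degeneracy as a cancellation rule: elements may be compared after covering one leg by an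
arbitrary c. It is the substitute for evaluating at a unit. -/
theorem LeftBase.ext1 (h : LeftBase s t) {w w' : LeftTensor s t}
    (H : ∀ c, LeftTensor.act1 s t c w = LeftTensor.act1 s t c w') : w = w' :=
  sub_eq_zero.1 (h.nondeg1 _ fun c => by rw [map_sub, H, sub_self])

theorem LeftBase.ext2 (h : LeftBase s t) {w w' : LeftTensor s t}
    (H : ∀ c, LeftTensor.act2 s t c w = LeftTensor.act2 s t c w') : w = w' :=
  sub_eq_zero.1 (h.nondeg2 _ fun c => by rw [map_sub, H, sub_self])

theorem RightBase.ext1 (h : RightBase s t) {w w' : RightTensor s t}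
    (H : ∀ c, RightTensor.act1 s t c w = RightTensor.act1 s t c w') : w = w' :=
  sub_eq_zero.1 (h.nondeg1 _ fun c => by rw [map_sub, H, sub_self])

theorem RightBase.ext2 (h : RightBase s t) {w w' : RightTensor s t}
    (H : ∀ c, RightTensor.act2 s t c w = RightTensor.act2 s t c w') : w = w' :=
  sub_eq_zero.1 (h.nondeg2 _ fun c => by rw [map_sub, H, sub_self])

/-- `Δ(a)(Δ(b)(1 ⊗ c)) = Δ(ab)(1 ⊗ c)` -/
theorem IsLeftMultiplierBialgebroid.mul_tr {Δ : A →ₗ[ℂ] leftTakeuchi s t}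
    (h : IsLeftMultiplierBialgebroid s t Δ) (a b c : A) :
    (Δ a).1 (h.base.tr Δ (b ⊗ₜ[ℂ] c)) = h.base.tr Δ ((a * b) ⊗ₜ[ℂ] c) := by
  refine h.base.ext1 fun d => ?_
  -- By the Takeuchi condition Δ(a)(p ⊗ q) = (Δ(a)(1 ⊗ q))(p ⊗ 1), so Δ(a) commutes with right
  -- multiplication in the first leg.
  have hc : LeftTensor.act1 s t d ∘ₗ (Δ a).1 = (Δ a).1 ∘ₗ LeftTensor.act1 s t d :=
    Bal.hom_ext fun p q => by
      obtain ⟨w, hw⟩ := (Δ a).2.2 q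
      rw [LinearMap.comp_apply, LinearMap.comp_apply, LeftTensor.act1_mk, hw, hw,
        LeftTensor.act1_act1]
  rw [← LinearMap.comp_apply, hc, LinearMap.comp_apply, LeftBase.tr_spec,
    LeftBase.tr_spec, h.map_mul, LinearMap.comp_apply]

/-- `((a ⊗ 1)Δ(b))Δ(c) = (a ⊗ 1)Δ(bc)` -/
theorem IsRightMultiplierBialgebroid.mul_lt {Δ : A →ₗ[ℂ] rightTakeuchi s t}
    (h : IsRightMultiplierBialgebroid s t Δ) (a b c : A) :
    (Δ c).1 (h.base.lt Δ (a ⊗ₜ[ℂ] b)) = h.base.lt Δ (a ⊗ₜ[ℂ] (b * c)) := by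
  refine h.base.ext2 fun d => ?_
  have hc : RightTensor.act2 s t d ∘ₗ (Δ c).1 = (Δ c).1 ∘ₗ RightTensor.act2 s t d :=
    Bal.hom_ext fun p q => by
      obtain ⟨w, hw⟩ := (Δ c).2.1 p
      rw [LinearMap.comp_apply, LinearMap.comp_apply, RightTensor.act2_mk, hw, hw,
        RightTensor.act2_act2]
  rw [← LinearMap.comp_apply, hc, LinearMap.comp_apply, RightBase.lt_spec,
    RightBase.lt_spec, h.map_mul, LinearMap.comp_apply]

/-- `(Δ(a)(1 ⊗ b))(1 ⊗ c) = Δ(a)(1 ⊗ bc)` -/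
theorem LeftBase.act2_tr (h : LeftBase s t) (Δ : A →ₗ[ℂ] leftTakeuchi s t) (a b c : A) :
    LeftTensor.act2 s t c (h.tr Δ (a ⊗ₜ[ℂ] b)) = h.tr Δ (a ⊗ₜ[ℂ] (b * c)) := by
  refine h.ext1 fun d => ?_
  -- Once the first leg is covered by d, the element is Δ(a)(d ⊗ b). It can be rewritten as (Δ(a)(d
  -- ⊗ 1))(1 ⊗ b), where the factor c is visibly absorbed into b.
  rw [LeftTensor.act1_act2, LeftBase.tr_spec, LeftBase.tr_spec, ← h.tl_spec,
    LeftTensor.act2_act2, LeftBase.tl_spec]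

/-- `(c ⊗ 1)((a ⊗ 1)Δ(b)) = (ca ⊗ 1)Δ(b)` -/
theorem RightBase.act1_lt (h : RightBase s t) (Δ : A →ₗ[ℂ] rightTakeuchi s t) (a b c : A) :
    RightTensor.act1 s t c (h.lt Δ (a ⊗ₜ[ℂ] b)) = h.lt Δ ((c * a) ⊗ₜ[ℂ] b) := by
  refine h.ext2 fun d => ?_
  rw [RightTensor.act2_act1, RightBase.lt_spec, RightBase.lt_spec, ← h.rt_spec,
    RightTensor.act1_act1, RightBase.rt_spec]

end

/-! ### The antipode on single legs, and its compatibility with multiplication. -/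

namespace MultiplierBialgebroid

variable {H : MultiplierBialgebroid A}

@[simp] theorem Tl_mk (a b : A) : H.Tl (Bal.mk _ _ a b) = H.left.base.tl H.ΔB (a ⊗ₜ[ℂ] b) := rfl

@[simp] theorem Tr_mk (a b : A) : H.Tr (Bal.mk _ _ a b) = H.left.base.tr H.ΔB (a ⊗ₜ[ℂ] b) := rfl

@[simp] theorem lT_mk (a b : A) : H.lT (Bal.mk _ _ a b) = H.right.base.lt H.ΔC (a ⊗ₜ[ℂ] b) := rfl

@[simp] theorem rT_mk (a b : A) : H.rT (Bal.mk _ _ a b) = H.right.base.rt H.ΔC (a ⊗ₜ[ℂ] b) := rfl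

@[simp] theorem flipC_mk (a b : A) : H.flipC (Bal.mk _ _ a b) = Bal.mk _ _ b a := rfl

@[simp] theorem flipB_mk (a b : A) : H.flipB (Bal.mk _ _ a b) = Bal.mk _ _ b a := rfl

namespace AntiAut

variable (S : H.AntiAut)

/-- `S ⊗ ι : _BA ⊗ A^B → A_C ⊗ _CA`, `a ⊗ b ↦ S(a) ⊗ b`. -/
noncomputable def sId : H.BA_AupB →ₗ[ℂ] H.AC_CA :=
  Bal.lift ((Bal.mk _ _).compl₁₂ S.S.toLinearMap LinearMap.id) (fun x a b => by
    simpa [S.lm_B] using (Bal.mk_bal (fun y => rm (incl H.C y))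
      (fun y => lm (incl H.C y)) (H.SB x) (S.S a) b))

/-- `ι ⊗ S : _BA ⊗ A_B → _BA ⊗ A^B`, `a ⊗ b ↦ a ⊗ S(b)`. -/
noncomputable def idSUp : H.BA_AB →ₗ[ℂ] H.BA_AupB :=
  Bal.lift ((Bal.mk _ _).compl₁₂ LinearMap.id S.S.toLinearMap) (fun x a b => by
    simpa [S.rm_B] using (Bal.mk_bal (fun x => lm (incl H.B x))
      (fun x => lm (incl H.C (H.SB x))) x a (S.S b)))

/-- `S ⊗ ι : _CA ⊗ A_C → ^CA ⊗ A_C`, `a ⊗ b ↦ S(a) ⊗ b`. -/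
noncomputable def sIdUp : H.CA_AC →ₗ[ℂ] H.upCA_AC :=
  Bal.lift ((Bal.mk _ _).compl₁₂ S.S.toLinearMap LinearMap.id) (fun y a b => by
    simpa [S.lm_C] using (Bal.mk_bal (fun y => rm (incl H.B (H.SC y)))
      (fun y => rm (incl H.C y)) y (S.S a) b))

@[simp] theorem sId_mk (a b : A) : S.sId (Bal.mk _ _ a b) = Bal.mk _ _ (S.S a) b := rfl

@[simp] theorem idSUp_mk (a b : A) : S.idSUp (Bal.mk _ _ a b) = Bal.mk _ _ a (S.S b) := rfl

@[simp] theorem sIdUp_mk (a b : A) : S.sIdUp (Bal.mk _ _ a b) = Bal.mk _ _ (S.S a) b := rfl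

@[simp] theorem idS_mk (a b : A) : S.idS (Bal.mk _ _ a b) = Bal.mk _ _ a (S.S b) := rfl

@[simp] theorem mS1_mk (a b : A) : S.mS1 (Bal.mk _ _ a b) = S.S a * b := rfl

@[simp] theorem mS2_mk (a b : A) : S.mS2 (Bal.mk _ _ a b) = a * S.S b := rfl

theorem flipS1_mk (a b : A) : S.flipS1 (Bal.mk _ _ a b) = Bal.mk _ _ (S.S b) a := rfl

theorem flipS2_mk (a b : A) : S.flipS2 (Bal.mk _ _ a b) = Bal.mk _ _ (S.S b) a := rfl

theorem flipS3_mk (a b : A) : S.flipS3 (Bal.mk _ _ a b) = Bal.mk _ _ b (S.S a) := rfl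

theorem flipS4_mk (a b : A) : S.flipS4 (Bal.mk _ _ a b) = Bal.mk _ _ b (S.S a) := rfl

/-- Separating the flip from the antipode in the diagonals and sides of the squares makes
`Tr_idS_lT` and `lT_sId_Tr` applicable, since these contain the antipode on one leg and the flip as
distinct factors. -/
theorem flipS1_eq : S.flipS1 = S.sIdUp ∘ₗ H.flipC := by
  refine Bal.hom_ext fun a b => ?_
  rw [LinearMap.comp_apply, flipC_mk, sIdUp_mk, flipS1_mk]

theorem flipS2_eq : S.flipS2 = H.flipB ∘ₗ S.idS := by
  refine Bal.hom_ext fun a b => ?_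
  rw [LinearMap.comp_apply, idS_mk, flipB_mk, flipS2_mk]

theorem flipS3_eq : S.flipS3 = S.idSUp ∘ₗ H.flipB := by
  refine Bal.hom_ext fun a b => ?_
  rw [LinearMap.comp_apply, flipB_mk, idSUp_mk, flipS3_mk]

theorem flipS4_eq : S.flipS4 = H.flipC ∘ₗ S.sId := by
  refine Bal.hom_ext fun a b => ?_
  rw [LinearMap.comp_apply, sId_mk, flipC_mk, flipS4_mk]

/-- S reverses products, so a factor on the right of the first leg comes out on the left. This rule
and its three companions transport the antipode axioms, given on the images of `Tr` and `lT`, to the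
images of `Tl` and `rT`. -/
theorem mS1_act1 (c : A) (w : H.BA_AupB) :
    S.mS1 (LeftTensor.act1 _ _ c w) = S.S c * S.mS1 w :=
  LinearMap.congr_fun (f := S.mS1 ∘ₗ LeftTensor.act1 _ _ c)
    (g := LinearMap.mulLeft ℂ (S.S c) ∘ₗ S.mS1)
    (Bal.hom_ext fun a b => show S.S (a * c) * b = S.S c * (S.S a * b) by rw [S.S_mul, mul_assoc]) w

theorem mS1_act2 (c : A) (w : H.BA_AupB) :
    S.mS1 (LeftTensor.act2 _ _ c w) = S.mS1 w * c :=
  LinearMap.congr_fun (f := S.mS1 ∘ₗ LeftTensor.act2 _ _ c)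
    (g := LinearMap.mulRight ℂ c ∘ₗ S.mS1)
    (Bal.hom_ext fun a b => (mul_assoc (S.S a) b c).symm) w

theorem mS2_act1 (c : A) (w : H.upCA_AC) :
    S.mS2 (RightTensor.act1 _ _ c w) = c * S.mS2 w :=
  LinearMap.congr_fun (f := S.mS2 ∘ₗ RightTensor.act1 _ _ c)
    (g := LinearMap.mulLeft ℂ c ∘ₗ S.mS2)
    (Bal.hom_ext fun a b => mul_assoc c a (S.S b)) w

theorem mS2_act2 (c : A) (w : H.upCA_AC) :
    S.mS2 (RightTensor.act2 _ _ c w) = S.mS2 w * S.S c :=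
  LinearMap.congr_fun (f := S.mS2 ∘ₗ RightTensor.act2 _ _ c)
    (g := LinearMap.mulRight ℂ (S.S c) ∘ₗ S.mS2)
    (Bal.hom_ext fun a b =>
      show a * S.S (c * b) = a * S.S b * S.S c by rw [S.S_mul, mul_assoc]) w

end AntiAut

theorem congr_comp₃ {U V V' W W' X : Type*} [AddCommGroup U] [AddCommGroup V] [AddCommGroup V']
    [AddCommGroup W] [AddCommGroup W'] [AddCommGroup X] [Module ℂ U] [Module ℂ V] [Module ℂ V']
    [Module ℂ W] [Module ℂ W'] [Module ℂ X] {f₁ : W →ₗ[ℂ] X} {f₂ : V →ₗ[ℂ] W} {f₃ : U →ₗ[ℂ] V}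
    {g₁ : W' →ₗ[ℂ] X} {g₂ : V' →ₗ[ℂ] W'} {g₃ : U →ₗ[ℂ] V'}
    (h : f₁ ∘ₗ f₂ ∘ₗ f₃ = g₁ ∘ₗ g₂ ∘ₗ g₃) (u : U) : f₁ (f₂ (f₃ u)) = g₁ (g₂ (g₃ u)) :=
  LinearMap.congr_fun h u

/-! ### Inversion formulas and triangles without inverses. -/

namespace InvertibleAntipode

variable (S : H.InvertibleAntipode)

/-- `Δ_B(b₁)(1 ⊗ S(b₂)S(c)) = b ⊗ S(c)`, where `b₁ ⊗ b₂ = Δ_C(b)`. -/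
theorem Tr_idS_rT : H.Tr ∘ₗ S.idS ∘ₗ H.rT = S.idSUp := by
  obtain ⟨εB, -, hB, -, -, h2⟩ := S.antipode
  -- This is q₁S(q₂)S(c) = S_B(ε_B(q))S(c). The axiom gives it with an extra d on the left, because
  -- (d ⊗ c)Δ_C(q) can be computed from either covering; d is then cancelled.
  have hm : ∀ q c : A, S.mS2 (H.right.base.rt H.ΔC (q ⊗ₜ[ℂ] c)) =
      lm (incl H.C (H.SB (εB q))) (S.S c) := fun q c => by
    rw [← sub_eq_zero]
    refine H.nondeg_left _ fun d => ?_
    rw [mul_sub, ← S.mS2_act1, RightBase.rt_spec, ← RightBase.lt_spec (h := H.right.base),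
      S.mS2_act2, ← lT_mk, h2, mul_lm, sub_self]
  refine Bal.hom_ext fun b c => ?_
  rw [LinearMap.comp_apply, LinearMap.comp_apply, rT_mk, AntiAut.idSUp_mk]
  refine H.left.base.ext1 fun a => ?_
  refine Eq.trans ?_ (LeftTensor.act1_mk a b (S.S c)).symm
  -- The product ba is expanded as ε_B(b₂)b₁a, the form in which the contracted condition delivers
  -- it.
  rw [← hB.counit2 a b]
  -- The contraction is p ⊗ q ⊗ r ↦ p ⊗ qS(r), computed by L₁ from the first two legs and by L₂ from
  -- the last two.
  refine H.mixed1.eval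
    (L₁ := (LeftTensor.act2ₗ _ _).compl₂ S.S.toLinearMap)
    (L₂ := (Bal.mk _ _).compl₂ S.mS2)
    (Φ := LeftTensor.act1 _ _ a ∘ₗ H.Tr ∘ₗ S.idS)
    (Ψ := (Bal.mk _ _).flip (S.S c) ∘ₗ H.left.base.slice2 εB hB.map_t) ?_ ?_ ?_ b
  · intro p q r
    exact congrArg (Bal.mk _ _ p) (S.mS2_mk q r).symm
  · intro p r
    rw [LinearMap.comp_apply, LinearMap.comp_apply, AntiAut.idS_mk, Tr_mk]
    exact (LeftBase.tr_spec ..).trans (LeftBase.tl_spec ..).symm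
  · intro p q
    rw [LinearMap.compl₂_apply, hm]
    -- The relation xa ⊗ b = a ⊗ S_B(x)b carries ε_B(q) over to the first leg.
    exact Bal.mk_bal _ _ _ _ _

/-- `(S(a)S(b₁) ⊗ 1)Δ_C(b₂) = S(a) ⊗ b`, where `b₁ ⊗ b₂ = Δ_B(b)`. -/
theorem lT_sId_Tl : H.lT ∘ₗ S.sId ∘ₗ H.Tl = S.sIdUp := by
  obtain ⟨-, εC, -, hC, h1, -⟩ := S.antipode
  have hm : ∀ a q : A, S.mS1 (H.left.base.tl H.ΔB (a ⊗ₜ[ℂ] q)) =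
      rm (incl H.B (H.SC (εC q))) (S.S a) := fun a q => by
    rw [← sub_eq_zero]
    refine H.nondeg_right _ fun d => ?_
    rw [sub_mul, ← S.mS1_act2, LeftBase.tl_spec, ← LeftBase.tr_spec (h := H.left.base),
      S.mS1_act1, ← Tr_mk, h1, mul_lm, sub_self]
  refine Bal.hom_ext fun a b => ?_
  rw [LinearMap.comp_apply, LinearMap.comp_apply, Tl_mk, AntiAut.sIdUp_mk]
  refine H.right.base.ext2 fun c => ?_
  refine Eq.trans ?_ (RightTensor.act2_mk c (S.S a) b).symm
  rw [← hC.counit1 b c]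
  -- The same condition, now contracted by p ⊗ q ⊗ r ↦ S(p)q ⊗ r. The counit ε_C moves from the
  -- first leg to the second by aS_C(y) ⊗ b = a ⊗ by.
  refine (H.mixed1.eval
    (L₁ := Bal.mk _ _ ∘ₗ S.mS1)
    (L₂ := RightTensor.act1ₗ _ _ ∘ₗ S.S.toLinearMap)
    (Φ := Bal.mk _ _ (S.S a) ∘ₗ H.right.base.slice1 εC hC.map_t)
    (Ψ := RightTensor.act2 _ _ c ∘ₗ H.lT ∘ₗ S.sId) ?_ ?_ ?_ b).symm
  · intro p q r
    exact LinearMap.congr_fun (congrArg (Bal.mk _ _) (S.mS1_mk p q)) r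
  · intro p r
    rw [LinearMap.comp_apply (Bal.mk _ _) S.mS1, hm]
    exact (Bal.mk_bal _ _ _ _ _).symm
  · intro p q
    rw [LinearMap.comp_apply, LinearMap.comp_apply, AntiAut.sId_mk, lT_mk]
    exact (RightBase.lt_spec ..).trans (RightBase.rt_spec ..).symm

/-- `T_ρ(ι ⊗ S)_λT = T_λΣ` -/
theorem Tr_idS_lT : H.Tr ∘ₗ S.idS ∘ₗ H.lT = H.Tl ∘ₗ H.flipC := by
  refine Bal.hom_ext fun a b => ?_
  rw [LinearMap.comp_apply, LinearMap.comp_apply, LinearMap.comp_apply, lT_mk, flipC_mk, Tl_mk]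
  refine H.left.base.ext2 fun d => ?_
  -- A covering element of the form S(c) can be pulled back through ι ⊗ S, where it becomes left
  -- multiplication by c.
  obtain ⟨c, rfl⟩ := S.S.surjective d
  have e₁ : LeftTensor.act2 _ _ (S.S c) ∘ₗ H.Tr ∘ₗ S.idS =
      H.Tr ∘ₗ S.idS ∘ₗ RightTensor.act2 _ _ c := by
    refine Bal.hom_ext fun p q => ?_
    rw [LinearMap.comp_apply, LinearMap.comp_apply, LinearMap.comp_apply, LinearMap.comp_apply,
      RightTensor.act2_mk, AntiAut.idS_mk, AntiAut.idS_mk, Tr_mk, Tr_mk, LeftBase.act2_tr,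
      S.S_mul]
  have e₂ : (H.ΔB a).1 ∘ₗ H.Tr ∘ₗ S.idS = H.Tr ∘ₗ S.idS ∘ₗ RightTensor.act1 _ _ a := by
    refine Bal.hom_ext fun p q => ?_
    rw [LinearMap.comp_apply, LinearMap.comp_apply, LinearMap.comp_apply, LinearMap.comp_apply,
      RightTensor.act1_mk, AntiAut.idS_mk, AntiAut.idS_mk, Tr_mk, Tr_mk, H.left.mul_tr]
  have e₃ := (congrArg (⇑H.Tr) (congrArg (⇑S.idS) (rT_mk b c))).symm.trans
    ((LinearMap.congr_fun S.Tr_idS_rT (Bal.mk _ _ b c)).trans (S.idSUp_mk b c))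
  -- Both sides are (a ⊗ c)Δ_C(b). This exchanges `lT` for `rT`, to which the inversion formula `e₃`
  -- applies, while a is extracted as Δ_B(a) by `e₂`.
  have e₄ := (H.right.base.lt_spec H.ΔC a b c).trans (H.right.base.rt_spec H.ΔC b c a).symm
  refine Eq.trans ?_ (H.left.base.tl_spec H.ΔB b a (S.S c)).symm
  have e₅ := congr_comp₃ e₁ (H.right.base.lt H.ΔC (a ⊗ₜ[ℂ] b))
  have e₆ := congr_comp₃ e₂ (H.right.base.rt H.ΔC (b ⊗ₜ[ℂ] c))
  have e₇ := congrArg (⇑H.Tr) (congrArg (⇑S.idS) e₄)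
  have e₈ := congrArg (⇑(H.ΔB a).1) e₃
  exact ((e₅.trans e₇).trans e₆.symm).trans e₈

/-- `_λT(S ⊗ ι)T_ρ = _ρTΣ` -/
theorem lT_sId_Tr : H.lT ∘ₗ S.sId ∘ₗ H.Tr = H.rT ∘ₗ H.flipB := by
  refine Bal.hom_ext fun a b => ?_
  rw [LinearMap.comp_apply, LinearMap.comp_apply, LinearMap.comp_apply, Tr_mk, flipB_mk, rT_mk]
  refine H.right.base.ext1 fun d => ?_
  obtain ⟨c, rfl⟩ := S.S.surjective d
  have e₁ : RightTensor.act1 _ _ (S.S c) ∘ₗ H.lT ∘ₗ S.sId =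
      H.lT ∘ₗ S.sId ∘ₗ LeftTensor.act1 _ _ c := by
    refine Bal.hom_ext fun p q => ?_
    rw [LinearMap.comp_apply, LinearMap.comp_apply, LinearMap.comp_apply, LinearMap.comp_apply,
      LeftTensor.act1_mk, AntiAut.sId_mk, AntiAut.sId_mk, lT_mk, lT_mk, RightBase.act1_lt,
      S.S_mul]
  have e₂ : (H.ΔC b).1 ∘ₗ H.lT ∘ₗ S.sId = H.lT ∘ₗ S.sId ∘ₗ LeftTensor.act2 _ _ b := by
    refine Bal.hom_ext fun p q => ?_
    rw [LinearMap.comp_apply, LinearMap.comp_apply, LinearMap.comp_apply, LinearMap.comp_apply,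
      LeftTensor.act2_mk, AntiAut.sId_mk, AntiAut.sId_mk, lT_mk, lT_mk, H.right.mul_lt]
  have e₃ := (congrArg (⇑H.lT) (congrArg (⇑S.sId) (Tl_mk c a))).symm.trans
    ((LinearMap.congr_fun S.lT_sId_Tl (Bal.mk _ _ c a)).trans (S.sIdUp_mk c a))
  -- Both sides are Δ_B(a)(c ⊗ b), which exchanges `Tr` for `Tl`.
  have e₄ := (H.left.base.tr_spec H.ΔB a b c).trans (H.left.base.tl_spec H.ΔB c a b).symm
  refine Eq.trans ?_ (H.right.base.rt_spec H.ΔC b a (S.S c)).symm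
  have e₅ := congr_comp₃ e₁ (H.left.base.tr H.ΔB (a ⊗ₜ[ℂ] b))
  have e₆ := congr_comp₃ e₂ (H.left.base.tl H.ΔB (c ⊗ₜ[ℂ] a))
  have e₇ := congrArg (⇑H.lT) (congrArg (⇑S.sId) e₄)
  have e₈ := congrArg (⇑(H.ΔC b).1) e₃
  exact ((e₅.trans e₇).trans e₆.symm).trans e₈

/-- `_ρT(S ⊗ ι)Σ_λT = (S ⊗ ι)Σ` -/
theorem rT_flipS2_lT : H.rT ∘ₗ S.flipS2 ∘ₗ H.lT = S.flipS1 := by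
  refine LinearMap.ext fun w => ?_
  -- Read from right to left, this replaces _ρTΣ by _λT(S ⊗ ι)T_ρ. Then `e₂` turns T_ρ(ι ⊗ S)_λT
  -- into T_λΣ, and `e₃` inverts T_λ.
  have e₁ := LinearMap.congr_fun S.lT_sId_Tr (S.idS (H.lT w))
  have e₂ := LinearMap.congr_fun S.Tr_idS_lT w
  have e₃ := LinearMap.congr_fun S.lT_sId_Tl (H.flipC w)
  rw [LinearMap.comp_apply, LinearMap.comp_apply, LinearMap.comp_apply] at e₁ e₂
  rw [LinearMap.comp_apply, LinearMap.comp_apply] at e₃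
  rw [LinearMap.comp_apply, LinearMap.comp_apply, S.flipS2_eq, S.flipS1_eq, LinearMap.comp_apply,
    LinearMap.comp_apply, ← e₁, e₂, e₃]

/-- `T_λ(ι ⊗ S)ΣT_ρ = (ι ⊗ S)Σ` -/
theorem Tl_flipS4_Tr : H.Tl ∘ₗ S.flipS4 ∘ₗ H.Tr = S.flipS3 := by
  refine LinearMap.ext fun w => ?_
  have e₁ := LinearMap.congr_fun S.Tr_idS_lT (S.sId (H.Tr w))
  have e₂ := LinearMap.congr_fun S.lT_sId_Tr w
  have e₃ := LinearMap.congr_fun S.Tr_idS_rT (H.flipB w)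
  rw [LinearMap.comp_apply, LinearMap.comp_apply, LinearMap.comp_apply] at e₁ e₂
  rw [LinearMap.comp_apply, LinearMap.comp_apply] at e₃
  rw [LinearMap.comp_apply, LinearMap.comp_apply, S.flipS4_eq, S.flipS3_eq, LinearMap.comp_apply,
    LinearMap.comp_apply, ← e₁, e₂, e₃]

end InvertibleAntipode

/-! ### Cancelling the canonical maps. -/

namespace IsRegularHopf

variable (hH : H.IsRegularHopf)

theorem TlInv_comp {X : Type*} [AddCommGroup X] [Module ℂ X] (F : X →ₗ[ℂ] H.CA_AC) :
    hH.TlInv ∘ₗ H.Tl ∘ₗ F = F :=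
  LinearMap.ext fun x => (LinearEquiv.ofBijective H.Tl hH.bij_Tl).symm_apply_apply (F x)

theorem TrInv_comp {X : Type*} [AddCommGroup X] [Module ℂ X] (F : X →ₗ[ℂ] H.AB_BA) :
    hH.TrInv ∘ₗ H.Tr ∘ₗ F = F :=
  LinearMap.ext fun x => (LinearEquiv.ofBijective H.Tr hH.bij_Tr).symm_apply_apply (F x)

theorem lTInv_comp {X : Type*} [AddCommGroup X] [Module ℂ X] (F : X →ₗ[ℂ] H.AC_CA) :
    hH.lTInv ∘ₗ H.lT ∘ₗ F = F :=
  LinearMap.ext fun x => (LinearEquiv.ofBijective H.lT hH.bij_lT).symm_apply_apply (F x)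

theorem rTInv_comp {X : Type*} [AddCommGroup X] [Module ℂ X] (F : X →ₗ[ℂ] H.BA_AB) :
    hH.rTInv ∘ₗ H.rT ∘ₗ F = F :=
  LinearMap.ext fun x => (LinearEquiv.ofBijective H.rT hH.bij_rT).symm_apply_apply (F x)

end IsRegularHopf

end MultiplierBialgebroid

end

end MultHopf

theorem mainTheorem6 {A : Type*} [NonUnitalRing A] [Module ℂ A] [IsScalarTower ℂ A A]
    [SMulCommClass ℂ A A] (H : MultHopf.MultiplierBialgebroid A) (hH : H.IsRegularHopf)
    (S : H.InvertibleAntipode) :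
    -- first square: the upper left corner to the lower right corner in three ways
    (S.flipS2 ∘ₗ H.lT = (H.flipB ∘ₗ hH.TrInv) ∘ₗ (H.Tl ∘ₗ H.flipC) ∧
      hH.rTInv ∘ₗ S.flipS1 = (H.flipB ∘ₗ hH.TrInv) ∘ₗ (H.Tl ∘ₗ H.flipC)) ∧
    -- second square
    (S.flipS4 ∘ₗ H.Tr = (H.flipC ∘ₗ hH.lTInv) ∘ₗ (H.rT ∘ₗ H.flipB) ∧
      hH.TlInv ∘ₗ S.flipS3 = (H.flipC ∘ₗ hH.lTInv) ∘ₗ (H.rT ∘ₗ H.flipB)) ∧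
    -- the lower left triangle of the first square without inverses
    H.Tr ∘ₗ S.idS ∘ₗ H.lT = H.Tl ∘ₗ H.flipC := by

  have h₁ : S.flipS2 ∘ₗ H.lT = (H.flipB ∘ₗ hH.TrInv) ∘ₗ (H.Tl ∘ₗ H.flipC) := by
    rw [← S.Tr_idS_lT, LinearMap.comp_assoc, hH.TrInv_comp, S.flipS2_eq, LinearMap.comp_assoc]
  have h₂ : S.flipS4 ∘ₗ H.Tr = (H.flipC ∘ₗ hH.lTInv) ∘ₗ (H.rT ∘ₗ H.flipB) := by
    rw [← S.lT_sId_Tr, LinearMap.comp_assoc, hH.lTInv_comp, S.flipS4_eq, LinearMap.comp_assoc]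
  -- In each square the remaining equality compares the two composites that contain S; there the
  -- inverse canonical map cancels directly.
  refine ⟨⟨h₁, ?_⟩, ⟨h₂, ?_⟩, S.Tr_idS_lT⟩
  · rw [← h₁, ← S.rT_flipS2_lT, hH.rTInv_comp]
  · rw [← h₂, ← S.Tl_flipS4_Tr, hH.TlInv_comp]
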